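/- **Theorem (Church–Ellenberg).** Let $\mathrm{FI}$ be the category of finite sets and injections, and $\mathrm{FB}$ the category of finite sets and bijections. An FI-module (resp. FB-module) over $\mathbb{Z}$ is a functor from $\mathrm{FI}$ (resp. $\mathrm{FB}$) to abelian groups. For an FI-module $W$ let $H_0(W)$ be the FB-module whose value at a finite set $T$ is the quotient of $W_T$ by the subgroup generated by the images of all maps $f_*\colon W_S\to W_T$ with $f\colon S\to T$ an injection that is not a bijection, and let FI-homology $H_p$ ($p\ge 0$) be the $p$-th left derived functor of $H_0\colon \mathrm{FI\text{-}Mod}\to\mathrm{FB\text{-}Mod}$. The degree of an FB-module $V$ is $\deg V=\sup\{|T| : V_T\neq 0\}\in\{-\infty\}\cup\mathbb{N}\cup\{\infty\}$, with $\deg 0=-\infty$. Put $f_p(W)=\deg H_p(W)-p\in[-\infty,\infty]$, and let $\operatorname{reg}(W)=\sup_{p\ge 1} f_p(W)$ be the Castelnuovo–Mumford regularity of $W$, i.e. the least $c \in [-\infty,\infty]$ with $\deg H_p(W)\le c+p$ for all $p\ge 1$. Use the convention $-\infty+x=x+(-\infty)=-\infty$ for all $x\in[-\infty,\infty]$. Then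 for every FI-module $W$ over $\mathbb{Z}$ (with no finiteness assumption): 1. $f_p(W)\le f_0(W)+f_1(W)$ for all $p\ge 1$; 2. if $H_1(W)\neq 0$, then the same inequality also holds for $p=0$, i.e. $f_0(W)\le f_0(W)+f_1(W)$; 3. $\operatorname{reg}(W)\le f_0(W)+f_1(W)$. -/

import Mathlib

open CategoryTheory CategoryTheory.Limits Opposite

universe u

/-! ### The categories FI and FB -/

/-- The category `FI`: its objects are the finite sets. -/
structure FI where
  carrier : Type
  [finite : Finite carrier]

attribute [instance] FI.finite

/-- The morphisms of `FI` are the injections. -/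
instance FI.category : Category.{0} FI where
  Hom S T := S.carrier ↪ T.carrier
  id S := Function.Embedding.refl S.carrier
  comp f g := Function.Embedding.trans f g

/-- The category `FB`: its objects are the finite sets. -/
structure FB where
  carrier : Type
  [finite : Finite carrier]

attribute [instance] FB.finite

/-- The morphisms of `FB` are the bijections. -/
instance FB.category : Category.{0} FB where
  Hom S T := S.carrier ≃ T.carrier
  id S := Equiv.refl S.carrier
  comp f g := Equiv.trans f g

/-- The inclusion of `FB` in `FI`. -/
def FB.toFI : FB ⥤ FI where
  obj T := ⟨T.carrier⟩
  map f := Equiv.toEmbedding f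

/-- The category of `FI`-modules over `ℤ`: functors from `FI` to abelian groups. -/
abbrev FIMod := FI ⥤ AddCommGrpCat.{u}

/-- The category of `FB`-modules over `ℤ`: functors from `FB` to abelian groups. -/
abbrev FBMod := FB ⥤ AddCommGrpCat.{u}

/-! ### The functor `H₀ : FIMod ⥤ FBMod` -/

/-- The injection underlying a morphism of `FI`. -/
def FI.toEmbedding {S T : FI} (f : S ⟶ T) : S.carrier ↪ T.carrier := f

/-- A morphism of `FI` is a bijection. -/
def FI.IsBij {S T : FI} (f : S ⟶ T) : Prop := Function.Bijective (FI.toEmbedding f)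

lemma FI.isBij_of_comp {R S T : FI} {f : R ⟶ S} {g : S ⟶ T} (h : FI.IsBij (f ≫ g)) :
    FI.IsBij f := by
  refine ⟨(FI.toEmbedding f).injective, fun y => ?_⟩
  obtain ⟨z, hz⟩ := h.2 (FI.toEmbedding g y)
  exact ⟨z, (FI.toEmbedding g).injective hz⟩

namespace FIMod

/-- The subgroup of `W_T` generated by the images of all maps `f_* : W_S → W_T`, where `f : S → T`
is an injection that is not a bijection. -/
def decomposables (W : FIMod.{u}) (T : FI) : AddSubgroup (W.obj T) :=
  ⨆ (S : FI) (f : S ⟶ T) (_ : ¬ FI.IsBij f), (W.map f).hom.range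

lemma map_mem_decomposables (W : FIMod.{u}) {S T : FI} (f : S ⟶ T) (hf : ¬ FI.IsBij f)
    (x : W.obj S) : (W.map f).hom x ∈ decomposables W T :=
  (le_iSup_of_le S (le_iSup_of_le f (le_iSup_of_le hf le_rfl)) :
    (W.map f).hom.range ≤ decomposables W T) ⟨x, rfl⟩

lemma decomposables_le_comap_map (W : FIMod.{u}) {S T : FI} (g : S ⟶ T) :
    decomposables W S ≤ (decomposables W T).comap (W.map g).hom := by
  unfold decomposables
  refine iSup_le fun R => iSup_le fun f => iSup_le fun hf => ?_
  rintro _ ⟨x, rfl⟩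
  rw [AddSubgroup.mem_comap, ← AddMonoidHom.comp_apply, ← AddCommGrpCat.hom_comp, ← W.map_comp]
  exact map_mem_decomposables W _ (fun h => hf (FI.isBij_of_comp h)) x

lemma decomposables_le_comap_app {V W : FIMod.{u}} (φ : V ⟶ W) (T : FI) :
    decomposables V T ≤ (decomposables W T).comap (φ.app T).hom := by
  unfold decomposables
  refine iSup_le fun R => iSup_le fun f => iSup_le fun hf => ?_
  rintro _ ⟨x, rfl⟩
  rw [AddSubgroup.mem_comap, ← AddMonoidHom.comp_apply, ← AddCommGrpCat.hom_comp, φ.naturality]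
  exact map_mem_decomposables W f hf _

/-- The `FB`-module `H₀(W)`, where `H₀(W)_T` is the quotient of `W_T` by the subgroup generated by
the images of all `f_* : W_S → W_T` with `f : S → T` a non-bijective injection. -/
def H₀Obj (W : FIMod.{u}) : FBMod.{u} where
  obj T := AddCommGrpCat.of (W.obj (FB.toFI.obj T) ⧸ decomposables W (FB.toFI.obj T))
  map g := AddCommGrpCat.ofHom
    (QuotientAddGroup.map _ _ _ (decomposables_le_comap_map W (FB.toFI.map g)))
  map_id T := by
    refine AddCommGrpCat.hom_ext (AddMonoidHom.ext fun x => ?_)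
    obtain ⟨x, rfl⟩ := QuotientAddGroup.mk_surjective x
    refine congrArg QuotientAddGroup.mk (?_ : (W.map (FB.toFI.map (𝟙 T))).hom x = x)
    rw [CategoryTheory.Functor.map_id, CategoryTheory.Functor.map_id]
    rfl
  map_comp f g := by
    refine AddCommGrpCat.hom_ext (AddMonoidHom.ext fun x => ?_)
    obtain ⟨x, rfl⟩ := QuotientAddGroup.mk_surjective x
    refine congrArg QuotientAddGroup.mk (?_ : (W.map (FB.toFI.map (f ≫ g))).hom x =
      (W.map (FB.toFI.map g)).hom ((W.map (FB.toFI.map f)).hom x))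
    rw [CategoryTheory.Functor.map_comp, CategoryTheory.Functor.map_comp]
    rfl

/-- The morphism `H₀(V) ⟶ H₀(W)` induced by `φ : V ⟶ W`. -/
def H₀Map {V W : FIMod.{u}} (φ : V ⟶ W) : H₀Obj V ⟶ H₀Obj W where
  app T := AddCommGrpCat.ofHom
    (QuotientAddGroup.map _ _ _ (decomposables_le_comap_app φ (FB.toFI.obj T)))
  naturality S T g := by
    refine AddCommGrpCat.hom_ext (AddMonoidHom.ext fun x => ?_)
    obtain ⟨x, rfl⟩ := QuotientAddGroup.mk_surjective x
    exact congrArg QuotientAddGroup.mk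
      (congrArg (fun h => h.hom x) (φ.naturality (FB.toFI.map g)))

lemma H₀Map_app_mk {V W : FIMod.{u}} (φ : V ⟶ W) (T : FB) (x : V.obj (FB.toFI.obj T)) :
    ((H₀Map φ).app T).hom (QuotientAddGroup.mk x) =
      QuotientAddGroup.mk ((φ.app (FB.toFI.obj T)).hom x) := rfl

lemma H₀Obj_hom_ext {V : FIMod.{u}} {W : FBMod.{u}} {φ ψ : H₀Obj V ⟶ W}
    (h : ∀ (T : FB) (x : V.obj (FB.toFI.obj T)),
      (φ.app T).hom (QuotientAddGroup.mk x) = (ψ.app T).hom (QuotientAddGroup.mk x)) : φ = ψ := by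
  refine NatTrans.ext (funext fun T => AddCommGrpCat.hom_ext (AddMonoidHom.ext fun x => ?_))
  obtain ⟨x, rfl⟩ := QuotientAddGroup.mk_surjective x
  exact h T x

/-- The functor `H₀ : FIMod ⥤ FBMod`. -/
def H₀ : FIMod.{u} ⥤ FBMod.{u} where
  obj W := H₀Obj W
  map φ := H₀Map φ
  map_id _ := H₀Obj_hom_ext fun _ _ => rfl
  map_comp _ _ := H₀Obj_hom_ext fun _ _ => rfl

instance : (H₀.{u}).Additive where
  map_add := H₀Obj_hom_ext fun _ _ => rfl

/-! ### Enough projectives -/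

/-- The free `FI`-module `M(S)`, with `M(S)_T = ℤ[Hom_FI(S, T)]`. -/
noncomputable def free (S : FI) : FIMod.{u} where
  obj T := AddCommGrpCat.of (FreeAbelianGroup (ULift.{u} (S ⟶ T)))
  map g := AddCommGrpCat.ofHom (FreeAbelianGroup.map fun f => ULift.up (f.down ≫ g))
  map_id T := by
    refine AddCommGrpCat.hom_ext (FreeAbelianGroup.lift_ext _ _ fun f => ?_)
    exact FreeAbelianGroup.map_of_apply _
  map_comp g h := by
    refine AddCommGrpCat.hom_ext (FreeAbelianGroup.lift_ext _ _ fun f => ?_)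
    refine (FreeAbelianGroup.map_of_apply _).trans ?_
    refine Eq.trans ?_ (congrArg (FreeAbelianGroup.map _)
      (FreeAbelianGroup.map_of_apply _)).symm
    exact (FreeAbelianGroup.map_of_apply _).symm

/-- The morphism `M(S) ⟶ W` that sends the generator `id_S` to `x`. -/
noncomputable def freeDesc {S : FI} {W : FIMod.{u}} (x : W.obj S) : free S ⟶ W where
  app T := AddCommGrpCat.ofHom
    (FreeAbelianGroup.lift fun f : ULift.{u} (S ⟶ T) => (W.map f.down).hom x)
  naturality T T' g := by
    refine AddCommGrpCat.hom_ext (FreeAbelianGroup.lift_ext _ _ fun f => ?_)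
    refine (congrArg (FreeAbelianGroup.lift _) (FreeAbelianGroup.map_of_apply _)).trans ?_
    refine (FreeAbelianGroup.lift_apply_of _ _).trans ?_
    refine Eq.trans ?_ (congrArg (W.map g).hom (FreeAbelianGroup.lift_apply_of _ _)).symm
    exact congrArg (fun h => h.hom x) (W.map_comp f.down g)

/-- The element of `M(S)_T` given by a morphism `f : S ⟶ T`. -/
noncomputable def freeOf {S T : FI} (f : S ⟶ T) : (free.{u} S).obj T :=
  (FreeAbelianGroup.of (ULift.up f) : FreeAbelianGroup (ULift.{u} (S ⟶ T)))

lemma freeDesc_app_freeOf {S T : FI} {W : FIMod.{u}} (x : W.obj S) (f : S ⟶ T) :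
    ((freeDesc x).app T).hom (freeOf f) = (W.map f).hom x :=
  FreeAbelianGroup.lift_apply_of _ _

lemma free_map_freeOf {S T T' : FI} (f : S ⟶ T) (g : T ⟶ T') :
    ((free.{u} S).map g).hom (freeOf f) = freeOf (f ≫ g) :=
  FreeAbelianGroup.map_of_apply _

lemma app_freeOf {S T : FI} {W : FIMod.{u}} (φ : free S ⟶ W) (f : S ⟶ T) :
    (φ.app T).hom (freeOf f) = (W.map f).hom ((φ.app S).hom (freeOf (𝟙 S))) := by
  rw [← AddMonoidHom.comp_apply, ← AddCommGrpCat.hom_comp, ← φ.naturality,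
    AddCommGrpCat.hom_comp, AddMonoidHom.comp_apply, free_map_freeOf, Category.id_comp]

lemma free_hom_ext {S : FI} {W : FIMod.{u}} {φ ψ : free S ⟶ W}
    (h : (φ.app S).hom (freeOf (𝟙 S)) = (ψ.app S).hom (freeOf (𝟙 S))) : φ = ψ := by
  apply NatTrans.ext
  funext T
  apply AddCommGrpCat.hom_ext
  apply FreeAbelianGroup.lift_ext
  rintro ⟨f⟩
  exact (app_freeOf φ f).trans ((congrArg _ h).trans (app_freeOf ψ f).symm)

instance free_projective (S : FI) : Projective (free.{u} S) where
  factors {E X} f e _ := by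
    obtain ⟨y, hy⟩ := (AddCommGrpCat.epi_iff_surjective (e.app S)).1 inferInstance
      ((f.app S).hom (freeOf (𝟙 S)))
    refine ⟨freeDesc y, free_hom_ext ?_⟩
    refine Eq.trans ?_ hy
    refine congrArg (e.app S).hom ((freeDesc_app_freeOf y (𝟙 S)).trans ?_)
    rw [E.map_id]
    rfl

instance : EnoughProjectives FIMod.{u} where
  presentation W := by
    let g : (Σ n : ℕ, W.obj ⟨Fin n⟩) → FIMod.{u} := fun i => free ⟨Fin i.1⟩
    let π : ∐ g ⟶ W := Sigma.desc fun i => freeDesc i.2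
    have (i : _) : Projective (g i) := free_projective _
    have : Epi π := by
      have (T : FI) : Epi (π.app T) := by
        rw [AddCommGrpCat.epi_iff_surjective]
        intro y
        let e : (⟨Fin (Nat.card T.carrier)⟩ : FI) ⟶ T :=
          (Finite.equivFin T.carrier).symm.toEmbedding
        let e' : T ⟶ (⟨Fin (Nat.card T.carrier)⟩ : FI) :=
          (Finite.equivFin T.carrier).toEmbedding
        have he : e' ≫ e = 𝟙 T :=
          Function.Embedding.ext fun t => (Finite.equivFin T.carrier).symm_apply_apply t
        let i : Σ n : ℕ, W.obj ⟨Fin n⟩ := ⟨Nat.card T.carrier, (W.map e').hom y⟩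
        refine ⟨((Sigma.ι g i).app T).hom (freeOf e), ?_⟩
        have h1 : Sigma.ι g i ≫ π = freeDesc i.2 := Sigma.ι_desc _ _
        have h2 := freeDesc_app_freeOf i.2 e
        rw [← h1] at h2
        refine h2.trans ?_
        change ((W.map e' ≫ W.map e).hom) y = y
        rw [← W.map_comp, he, W.map_id]
        rfl
      exact NatTrans.epi_of_epi_app π
    have : Projective (∐ g) :=
      { factors := fun f e _ =>
          ⟨Sigma.desc fun i => Projective.factorThru (Sigma.ι g i ≫ f) e,
            Sigma.hom_ext _ _ fun i => by
              rw [← Category.assoc, Sigma.ι_desc, Projective.factorThru_comp]⟩ }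
    exact ⟨⟨∐ g, π⟩⟩

/-! ### FI-homology, degrees and regularity -/

/-- FI-homology `H_p : FIMod ⥤ FBMod`: the `p`-th left derived functor of `H₀`. -/
noncomputable def H (p : ℕ) : FIMod.{u} ⥤ FBMod.{u} := H₀.leftDerived p

/-- The degree of an `FB`-module: the supremum, in `[-∞, ∞]`, of the cardinalities of the finite
sets `T` with `V_T ≠ 0`. The degree of the zero module is `-∞`. -/
noncomputable def deg (V : FBMod.{u}) : EReal :=
  ⨆ (T : FB) (_ : ¬ IsZero (V.obj T)), ((Nat.card T.carrier : ℕ) : EReal)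

/-- `f_p(W) = deg H_p(W) - p`. -/
noncomputable def f (p : ℕ) (W : FIMod.{u}) : EReal := deg ((H p).obj W) - ((p : ℕ) : EReal)

/-- The Castelnuovo–Mumford regularity of `W`: the least `c` in `[-∞, ∞]` such that
`deg H_p(W) ≤ c + p` for all `p ≥ 1`. -/
noncomputable def regularity (W : FIMod.{u}) : EReal := ⨆ (p : ℕ) (_ : 1 ≤ p), f p W

end FIMod

/-! Let `D W` and `K W` be the cokernel and kernel of the map from `W` to its shift `T ↦ W_{T ⊔ *}`.
There is a natural isomorphism `H₀(D W)_T ≅ H₀(W)_{T ⊔ *}`, the functor `D` takes free modules to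
projective ones, and by the snake lemma `K` is the first left derived functor of `D`, the higher
ones being zero. Hence there is a long exact sequence `H_p(K W)_T → H_{p+1}(W)_{T ⊔ *} → H_{p+1}(D
W)_T → H_{p-1}(K W)_T → H_p(W)_{T ⊔ *}`. Only three consequences of it are needed:
`vanishes_one_deriv`, `vanishes_zero_K` and `vanishes_succ_plus`.

Passing from `W` to `D W` lowers the degrees of generators and relations by one, so induction bounds
the homology of `D W`. Through `H₂(D W) → H₀(K W) → H₁(W)` this bounds the degree of `H₀(K W)`.
Non-bijective injections act by zero on `K W`, so `H₀(K W) = K W`, and `K W` vanishes on large sets.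
A module vanishing on sets of size at least `N` has `H_p` vanishing in size at least `N + p`
(`vanishes_of_isZero_ge`), and the sequence then bounds the homology of `W` (`vanishes_of_bounds`).
The base case `H₁(W) = 0` is `vanishes_of_vanishes_one`.

Homology is handled dually. For injective `A`, `Hom(H_p(W)_T, A)` is `Ext^p(W, coind T A)`, so
`H_p(W)_T = 0` becomes the vanishing of these groups (`vanishes_iff_isZero_H`), and the long exact
sequence becomes extension problems for morphisms. -/

namespace FI

/-! ### Adding a point to a finite set and deleting one. -/

/-- Adding a point to a finite set. -/
def plus : FI ⥤ FI where
  obj T := ⟨Option T.carrier⟩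
  map f := Function.Embedding.optionMap (toEmbedding f)
  map_id _ := Function.Embedding.ext fun x => by cases x <;> rfl
  map_comp _ _ := Function.Embedding.ext fun x => by cases x <;> rfl

/-- The inclusion of a finite set in the set with one more point. -/
def incl : 𝟭 FI ⟶ plus where
  app _ := Function.Embedding.some
  naturality _ _ _ := Function.Embedding.ext fun _ => rfl

lemma hom_ext {S T : FI} {f g : S ⟶ T} (h : ∀ x, toEmbedding f x = toEmbedding g x) : f = g :=
  Function.Embedding.ext h

lemma toEmbedding_comp {R S T : FI} (f : R ⟶ S) (g : S ⟶ T) (x : R.carrier) :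
    toEmbedding (f ≫ g) x = toEmbedding g (toEmbedding f x) := rfl

lemma not_isBij_incl (S : FI) : ¬ IsBij (incl.app S) := fun h => by
  obtain ⟨x, hx⟩ := h.2 (none : Option S.carrier)
  cases hx

lemma isBij_comp_iff {R S T : FI} (f : R ⟶ S) (g : S ⟶ T) (hf : IsBij f) :
    IsBij (f ≫ g) ↔ IsBij g := by
  refine ⟨fun h => ⟨(toEmbedding g).injective, fun y => ?_⟩, fun h => h.comp hf⟩
  obtain ⟨x, hx⟩ := h.2 y
  exact ⟨_, hx⟩

lemma isBij_of_comp_right {R S T : FI} (f : R ⟶ S) (g : S ⟶ T) (h : IsBij (f ≫ g)) :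
    IsBij g := (isBij_comp_iff f g (isBij_of_comp h)).1 h

lemma isBij_plus_iff {S T : FI} (f : S ⟶ T) : IsBij (plus.map f) ↔ IsBij f := by
  refine ⟨fun h => ⟨(toEmbedding f).injective, fun y => ?_⟩,
    fun h => ⟨(toEmbedding (plus.map f)).injective, fun y => ?_⟩⟩
  · obtain ⟨x, hx⟩ := h.2 (some y : Option T.carrier)
    cases x with
    | none => cases hx
    | some x => exact ⟨x, Option.some_injective _ hx⟩
  · cases y with
    | none => exact ⟨(none : Option S.carrier), rfl⟩
    | some y =>
      obtain ⟨x, rfl⟩ := h.2 y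
      exact ⟨(some x : Option S.carrier), rfl⟩

/-- The bijective morphism given by an equivalence. -/
def ofEquiv {S T : FI} (e : S.carrier ≃ T.carrier) : S ⟶ T := e.toEmbedding

/-- The isomorphism given by an equivalence. -/
def isoOfEquiv {S T : FI} (e : S.carrier ≃ T.carrier) : S ≅ T where
  hom := ofEquiv e
  inv := ofEquiv e.symm
  hom_inv_id := hom_ext e.symm_apply_apply
  inv_hom_id := hom_ext e.apply_symm_apply

lemma exists_incl_comp_of_not_isBij {S T : FI} (f : S ⟶ T) (hf : ¬ IsBij f) :
    ∃ g : plus.obj S ⟶ T, f = incl.app S ≫ g := by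
  have : ∃ t, ∀ s, toEmbedding f s ≠ t := by
    by_contra! h
    exact hf ⟨(toEmbedding f).injective, h⟩
  obtain ⟨t, ht⟩ := this
  exact ⟨Function.Embedding.optionElim (toEmbedding f) t (by rintro ⟨s, hs⟩; exact ht s hs), rfl⟩

/-- The complement of a point. -/
def del (S : FI) (s : S.carrier) : FI := ⟨{x : S.carrier // x ≠ s}⟩

open Classical in
/-- The map that sends `s` to the added point and is the identity elsewhere. -/
noncomputable def splitFun {α : Type} (s x : α) : Option {x : α // x ≠ s} :=
  if h : x = s then none else some ⟨x, h⟩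

lemma splitFun_self {α : Type} (s : α) : splitFun s s = none := dif_pos rfl

lemma splitFun_of_ne {α : Type} (s x : α) (h : x ≠ s) : splitFun s x = some ⟨x, h⟩ := dif_neg h

lemma splitFun_injective {α : Type} (s : α) : Function.Injective (splitFun s) := by
  intro x y h
  by_cases hx : x = s <;> by_cases hy : y = s
  · rw [hx, hy]
  · rw [hx, splitFun_self, splitFun_of_ne s y hy] at h
    cases h
  · rw [hy, splitFun_self, splitFun_of_ne s x hx] at h
    cases h
  · rw [splitFun_of_ne s x hx, splitFun_of_ne s y hy] at h
    exact congrArg Subtype.val (Option.some_injective _ h)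

/-- A finite set as the complement of a point with a point added. -/
noncomputable def split (S : FI) (s : S.carrier) : S ⟶ plus.obj (del S s) :=
  ⟨splitFun s, splitFun_injective s⟩

lemma split_self (S : FI) (s : S.carrier) :
    toEmbedding (split S s) s = (none : Option (del S s).carrier) := splitFun_self s

lemma split_of_ne (S : FI) (s : S.carrier) (x : S.carrier) (h : x ≠ s) :
    toEmbedding (split S s) x = (some ⟨x, h⟩ : Option (del S s).carrier) := splitFun_of_ne s x h

lemma isBij_split (S : FI) (s : S.carrier) : IsBij (split S s) := by
  refine ⟨(toEmbedding _).injective, fun y => ?_⟩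
  cases y with
  | none => exact ⟨s, split_self S s⟩
  | some y => exact ⟨y.1, split_of_ne S s y.1 y.2⟩

/-- The restriction to the complement of `s` of an injection that sends `s` to the added point. -/
noncomputable def restr {S T : FI} (g : S ⟶ plus.obj T) (s : S.carrier)
    (hs : toEmbedding g s = (none : Option T.carrier)) : del S s ⟶ T :=
  have H (x : (del S s).carrier) : ∃ t : T.carrier, (some t : Option T.carrier) =
      toEmbedding g x.1 :=
    Option.ne_none_iff_exists.1 fun hx => x.2 ((toEmbedding g).injective (hx.trans hs.symm))
  { toFun := fun x => (H x).choose
    inj' := fun x y h => Subtype.ext ((toEmbedding g).injective (by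
      rw [← (H x).choose_spec, ← (H y).choose_spec]
      exact congrArg _ h)) }

lemma some_restr {S T : FI} (g : S ⟶ plus.obj T) (s : S.carrier)
    (hs : toEmbedding g s = (none : Option T.carrier)) (x : (del S s).carrier) :
    (some (toEmbedding (restr g s hs) x) : Option T.carrier) = toEmbedding g x.1 :=
  Exists.choose_spec (p := fun t : T.carrier => (some t : Option T.carrier) =
    toEmbedding g x.1) _

lemma split_comp_restr {S T : FI} (g : S ⟶ plus.obj T) (s : S.carrier)
    (hs : toEmbedding g s = (none : Option T.carrier)) :
    split S s ≫ plus.map (restr g s hs) = g := by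
  refine hom_ext fun x => ?_
  rw [toEmbedding_comp]
  by_cases h : x = s
  · subst h
    rw [split_self, hs]
    rfl
  · rw [split_of_ne S s x h]
    exact some_restr g s hs ⟨x, h⟩

lemma restr_comp {S T T' : FI} (g : S ⟶ plus.obj T) (k : T ⟶ T') (s : S.carrier)
    (hs : toEmbedding g s = (none : Option T.carrier))
    (hs' : toEmbedding (g ≫ plus.map k) s = (none : Option T'.carrier)) :
    restr (g ≫ plus.map k) s hs' = restr g s hs ≫ k := by
  refine hom_ext fun x => Option.some_injective _ ?_
  rw [some_restr, toEmbedding_comp, toEmbedding_comp, ← some_restr g s hs]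
  rfl

/-- The corestriction of an injection that misses the added point. -/
noncomputable def corestr {S T : FI} (g : S ⟶ plus.obj T)
    (hg : ∀ s, toEmbedding g s ≠ (none : Option T.carrier)) : S ⟶ T where
  toFun s := (Option.ne_none_iff_exists.1 (hg s)).choose
  inj' x y h := (toEmbedding g).injective (by
    rw [← (Option.ne_none_iff_exists.1 (hg x)).choose_spec,
      ← (Option.ne_none_iff_exists.1 (hg y)).choose_spec]
    exact congrArg _ h)

lemma some_corestr {S T : FI} (g : S ⟶ plus.obj T)
    (hg : ∀ s, toEmbedding g s ≠ (none : Option T.carrier)) (s : S.carrier) :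
    (some (toEmbedding (corestr g hg) s) : Option T.carrier) = toEmbedding g s :=
  (Option.ne_none_iff_exists.1 (hg s)).choose_spec

lemma corestr_comp_incl {S T : FI} (g : S ⟶ plus.obj T)
    (hg : ∀ s, toEmbedding g s ≠ (none : Option T.carrier)) :
    corestr g hg ≫ incl.app T = g :=
  hom_ext fun s => some_corestr g hg s

end FI

/-! ### Coinduced modules and the right adjoint of `H₀` at a finite set. -/

namespace FIMod

/-- The functions on `Hom(R, T)` with values in `A` that vanish outside the bijections. -/
def coindSubgroup (T : FI) (A : AddCommGrpCat.{u}) (R : FI) : AddSubgroup ((R ⟶ T) → A) where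
  carrier := {φ | ∀ g, ¬ FI.IsBij g → φ g = 0}
  zero_mem' _ _ := rfl
  add_mem' ha hb g hg := by simp [ha g hg, hb g hg]
  neg_mem' ha g hg := by simp [ha g hg]

/-- The `FI`-module that represents the homomorphisms `H₀(W)_T → A`. -/
def coind (T : FI) (A : AddCommGrpCat.{u}) : FIMod.{u} where
  obj R := AddCommGrpCat.of (coindSubgroup T A R)
  map {R R'} f := AddCommGrpCat.ofHom
    { toFun φ := ⟨fun g => φ.1 (f ≫ g), fun g hg =>
        φ.2 _ fun h => hg (FI.isBij_of_comp_right f g h)⟩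
      map_zero' := rfl
      map_add' _ _ := rfl }

/-- Evaluation at the identity. -/
def coindEval (T : FI) (A : AddCommGrpCat.{u}) : (coind T A).obj T ⟶ A :=
  AddCommGrpCat.ofHom
    { toFun φ := φ.1 (𝟙 T)
      map_zero' := rfl
      map_add' _ _ := rfl }

variable {T : FI} {A : AddCommGrpCat.{u}} {X Y : FIMod.{u}}

/-- By naturality along `g`, a morphism to `coind T A` is determined by its component at `T`
followed by evaluation at the identity. -/
lemma coind_app_apply (φ : X ⟶ coind T A) {R : FI} (x : X.obj R) (g : R ⟶ T) :
    ((φ.app R).hom x).1 g = (φ.app T ≫ coindEval T A).hom ((X.map g).hom x) := by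
  have h := congrArg (fun k => k.hom x) (φ.naturality g)
  have h2 := congrArg (fun k : coindSubgroup T A T => k.1 (𝟙 T)) h
  refine Eq.trans ?_ h2.symm
  change _ = ((φ.app R).hom x).1 (g ≫ 𝟙 T)
  rw [Category.comp_id]

lemma coind_hom_ext {φ ψ : X ⟶ coind T A}
    (h : φ.app T ≫ coindEval T A = ψ.app T ≫ coindEval T A) : φ = ψ := by
  refine NatTrans.ext (funext fun R => AddCommGrpCat.hom_ext (AddMonoidHom.ext fun x =>
    Subtype.ext (funext fun g => ?_)))
  refine (coind_app_apply φ x g).trans ?_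
  rw [h]
  exact (coind_app_apply ψ x g).symm

lemma map_comp_coindEval (φ : X ⟶ coind T A) {R : FI} (f : R ⟶ T) (hf : ¬ FI.IsBij f) :
    X.map f ≫ φ.app T ≫ coindEval T A = 0 := by
  refine AddCommGrpCat.hom_ext (AddMonoidHom.ext fun x => ?_)
  exact (coind_app_apply φ x f).symm.trans (((φ.app R).hom x).2 f hf)

/-- The morphism to `coind T A` given by a homomorphism on `X_T` that kills the images of all
injections that are not bijections. -/
def coindLift (α : X.obj T ⟶ A)
    (hα : ∀ (R : FI) (f : R ⟶ T), ¬ FI.IsBij f → X.map f ≫ α = 0) : X ⟶ coind T A where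
  app R := AddCommGrpCat.ofHom
    { toFun x := ⟨fun g => α.hom ((X.map g).hom x), fun g hg =>
        congrArg (fun k => k.hom x) (hα R g hg)⟩
      map_zero' := Subtype.ext (funext fun g => by simp)
      map_add' x y := Subtype.ext (funext fun g => by simp) }
  naturality R R' f := by
    refine AddCommGrpCat.hom_ext (AddMonoidHom.ext fun x => Subtype.ext (funext fun g => ?_))
    change α.hom ((X.map g).hom ((X.map f).hom x)) = α.hom ((X.map (f ≫ g)).hom x)
    rw [X.map_comp]
    rfl

lemma coindLift_app_eval (α : X.obj T ⟶ A)
    (hα : ∀ (R : FI) (f : R ⟶ T), ¬ FI.IsBij f → X.map f ≫ α = 0) :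
    (coindLift α hα).app T ≫ coindEval T A = α := by
  refine AddCommGrpCat.hom_ext (AddMonoidHom.ext fun x => ?_)
  change α.hom ((X.map (𝟙 T)).hom x) = α.hom x
  rw [X.map_id]
  rfl


/-- The functor `W ↦ H₀(W)_T`. -/
noncomputable def H₀At (T : FB) : FIMod.{u} ⥤ AddCommGrpCat.{u} :=
  H₀ ⋙ (evaluation FB AddCommGrpCat).obj T

/-- The projection `W_T → H₀(W)_T`. -/
def H₀π (X : FIMod.{u}) (T : FB) : X.obj (FB.toFI.obj T) ⟶ (H₀At T).obj X :=
  AddCommGrpCat.ofHom (QuotientAddGroup.mk' (decomposables X (FB.toFI.obj T)))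

instance (X : FIMod.{u}) (T : FB) : Epi (H₀π X T) :=
  (AddCommGrpCat.epi_iff_surjective _).2 QuotientAddGroup.mk_surjective

lemma H₀π_naturality {X Y : FIMod.{u}} (f : X ⟶ Y) (T : FB) :
    f.app (FB.toFI.obj T) ≫ H₀π Y T = H₀π X T ≫ (H₀At T).map f := rfl

lemma map_comp_H₀π (X : FIMod.{u}) (T : FB) {R : FI} (f : R ⟶ FB.toFI.obj T)
    (hf : ¬ FI.IsBij f) : X.map f ≫ H₀π X T = 0 :=
  AddCommGrpCat.hom_ext (AddMonoidHom.ext fun x =>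
    (QuotientAddGroup.eq_zero_iff _).2 (map_mem_decomposables X f hf x))

lemma exists_H₀π_comp (X : FIMod.{u}) (T : FB) {A : AddCommGrpCat.{u}}
    (α : X.obj (FB.toFI.obj T) ⟶ A)
    (hα : ∀ (R : FI) (f : R ⟶ FB.toFI.obj T), ¬ FI.IsBij f → X.map f ≫ α = 0) :
    ∃ β : (H₀At T).obj X ⟶ A, H₀π X T ≫ β = α := by
  refine ⟨AddCommGrpCat.ofHom (QuotientAddGroup.lift _ α.hom ?_), rfl⟩
  refine iSup_le fun R => iSup_le fun f => iSup_le fun hf => ?_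
  rintro _ ⟨x, rfl⟩
  exact congrArg (fun k => k.hom x) (hα R f hf)

lemma map_comp_H₀π_comp (X : FIMod.{u}) (T : FB) {A : AddCommGrpCat.{u}}
    (β : (H₀At T).obj X ⟶ A) (R : FI) (f : R ⟶ FB.toFI.obj T) (hf : ¬ FI.IsBij f) :
    X.map f ≫ H₀π X T ≫ β = 0 := by
  rw [← Category.assoc, map_comp_H₀π X T f hf, zero_comp]

/-- `coind T A` represents the homomorphisms `H₀(X)_T → A`. -/
noncomputable def coindEquiv (T : FB) (X : FIMod.{u}) (A : AddCommGrpCat.{u}) :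
    ((H₀At T).obj X ⟶ A) ≃ (X ⟶ coind (FB.toFI.obj T) A) :=
  Equiv.ofBijective
    (fun β => coindLift (H₀π X T ≫ β) (map_comp_H₀π_comp X T β)) (by
    constructor
    · intro β β' h
      rw [← cancel_epi (H₀π X T), ← coindLift_app_eval _ (map_comp_H₀π_comp X T β),
        ← coindLift_app_eval _ (map_comp_H₀π_comp X T β')]
      exact congrArg (fun k => NatTrans.app k _ ≫ _) h
    · intro φ
      obtain ⟨β, hβ⟩ := exists_H₀π_comp X T _ fun R f hf => map_comp_coindEval φ f hf
      exact ⟨β, coind_hom_ext ((coindLift_app_eval _ _).trans hβ)⟩)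

lemma coindEquiv_app_eval (T : FB) (X : FIMod.{u}) (A : AddCommGrpCat.{u})
    (β : (H₀At T).obj X ⟶ A) :
    (coindEquiv T X A β).app _ ≫ coindEval _ A = H₀π X T ≫ β :=
  coindLift_app_eval _ (map_comp_H₀π_comp X T β)

lemma coindEquiv_naturality (T : FB) {X Y : FIMod.{u}} (A : AddCommGrpCat.{u}) (f : X ⟶ Y)
    (β : (H₀At T).obj Y ⟶ A) :
    coindEquiv T X A ((H₀At T).map f ≫ β) = f ≫ coindEquiv T Y A β := by
  refine coind_hom_ext ?_
  rw [coindEquiv_app_eval, NatTrans.comp_app, Category.assoc, coindEquiv_app_eval,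
    ← Category.assoc, ← Category.assoc, H₀π_naturality]

instance (T : FB) : (H₀At.{u} T).IsLeftAdjoint :=
  (Adjunction.adjunctionOfEquivRight (coindEquiv T)
    fun _ _ A f β => coindEquiv_naturality T A f β).isLeftAdjoint

instance (T : FB) : (H₀At.{u} T).Additive := by
  unfold H₀At
  infer_instance

/-- Each `H₀At T` is a left adjoint, so `H₀` is right exact. This is what identifies the zeroth left
derived functor with `H₀`. -/
instance : PreservesFiniteColimits H₀.{u} where
  preservesFiniteColimits J _ _ :=
    preservesColimitsOfShape_of_evaluation _ _ fun T =>
      (inferInstance : PreservesColimitsOfShape J (H₀At.{u} T))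

/-! ### Detecting FI-homology by extensions -/

instance : HasExt.{max 1 u} FIMod.{u} := hasExt_of_enoughProjectives _

/-- All extensions of degree `p` of `W` by the coinduced modules at `T` vanish. This is a dual form
of the vanishing of `H_p(W)_T`. -/
def Vanishes (p : ℕ) (W : FIMod.{u}) (T : FI) : Prop :=
  ∀ (A : AddCommGrpCat.{u}) [Injective A] (e : Abelian.Ext W (coind T A) p), e = 0

lemma exact_iff_injective {C : Type*} [Category* C] [Abelian C] [EnoughInjectives C]
    (S : ShortComplex C) :
    S.Exact ↔ ∀ (A : C) [Injective A] (f : S.X₂ ⟶ A), S.f ≫ f = 0 →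
      ∃ g : S.X₃ ⟶ A, S.g ≫ g = f := by
  refine ⟨fun h A _ f hf => ⟨h.descToInjective f hf, h.comp_descToInjective f hf⟩, fun h => ?_⟩
  rw [S.exact_iff_kernel_ι_comp_cokernel_π_zero]
  -- The test map is the cokernel of `S.f` embedded in an injective object; it factors through
  -- `S.g`, hence kills the kernel of `S.g`.
  obtain ⟨g, hg⟩ := h _ (cokernel.π S.f ≫ Injective.ι _) (by rw [cokernel.condition_assoc, zero_comp])
  rw [← cancel_mono (Injective.ι _), Category.assoc, ← hg, kernel.condition_assoc, zero_comp,
    zero_comp]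

lemma isZero_iff_injective {C : Type*} [Category* C] [Abelian C] [EnoughInjectives C] (X : C) :
    IsZero X ↔ ∀ (A : C) [Injective A] (f : X ⟶ A), f = 0 := by
  refine ⟨fun h A _ f => h.eq_of_src _ _, fun h => ?_⟩
  rw [IsZero.iff_id_eq_zero, ← cancel_mono (Injective.ι X), h _ (𝟙 X ≫ _), zero_comp]

lemma vanishes_zero_iff (W : FIMod.{u}) (T : FI) :
    Vanishes 0 W T ↔ ∀ (A : AddCommGrpCat.{u}) [Injective A] (f : W ⟶ coind T A), f = 0 := by
  refine forall_congr' fun A => forall_congr' fun _ => ⟨fun h f => ?_, fun h e => ?_⟩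
  · rw [← Abelian.Ext.mk₀_eq_zero_iff]
    exact h _
  · obtain ⟨f, rfl⟩ := (Abelian.Ext.mk₀_bijective _ _).2 e
    rw [h f, Abelian.Ext.mk₀_zero]

lemma vanishes_zero_iff_isZero_H₀ (W : FIMod.{u}) (T : FB) :
    Vanishes 0 W (FB.toFI.obj T) ↔ IsZero ((H₀At T).obj W) := by
  rw [vanishes_zero_iff, isZero_iff_injective]
  refine forall_congr' fun A => forall_congr' fun _ => ⟨fun h f => ?_, fun h f => ?_⟩
  · exact (coindEquiv T W A).injective ((h _).trans (h _).symm)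
  · exact (coindEquiv T W A).symm.injective ((h _).trans (h _).symm)

lemma coindEquiv_zero (T : FB) (X : FIMod.{u}) (A : AddCommGrpCat.{u}) :
    coindEquiv T X A 0 = 0 := by
  refine coind_hom_ext ?_
  rw [coindEquiv_app_eval, comp_zero, zero_app, zero_comp]

lemma map_comp_eq_iff (T : FB) {X Y : FIMod.{u}} (A : AddCommGrpCat.{u}) (f : X ⟶ Y)
    (β : (H₀At T).obj X ⟶ A) (γ : (H₀At T).obj Y ⟶ A) :
    (H₀At T).map f ≫ γ = β ↔ f ≫ coindEquiv T Y A γ = coindEquiv T X A β := by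
  rw [← coindEquiv_naturality, EmbeddingLike.apply_eq_iff_eq]

lemma exact_map_H₀At_iff (S : ShortComplex FIMod.{u}) (T : FB) :
    (S.map (H₀At T)).Exact ↔ ∀ (A : AddCommGrpCat.{u}) [Injective A]
      (φ : S.X₂ ⟶ coind (FB.toFI.obj T) A), S.f ≫ φ = 0 → ∃ ψ, S.g ≫ ψ = φ := by
  rw [exact_iff_injective]
  refine forall_congr' fun A => forall_congr' fun _ => ?_
  rw [← (coindEquiv T S.X₂ A).forall_congr_right]
  refine forall_congr' fun f => imp_congr 
    ((map_comp_eq_iff T A S.f 0 f).trans (by rw [coindEquiv_zero])) ?_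
  rw [← (coindEquiv T S.X₃ A).exists_congr_right]
  exact exists_congr fun g => map_comp_eq_iff T A S.g f g

/-- A class in `Ext^{p+1}` is a cocycle on `P_{p+1}`, and it is zero when the cocycle factors
through the differential to `P_p`. By adjunction this is exactness after `H₀At T`, tested against
injective groups. -/
lemma vanishes_succ_iff_exact {W : FIMod.{u}} (P : ProjectiveResolution W) (p : ℕ) (T : FB) :
    Vanishes (p + 1) W (FB.toFI.obj T) ↔
      ((P.complex.sc' (p + 2) (p + 1) p).map (H₀At T)).Exact := by
  rw [exact_map_H₀At_iff]
  refine forall_congr' fun A => forall_congr' fun _ => ⟨fun h φ hφ => ?_, fun h e => ?_⟩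
  · exact (P.extMk_eq_zero_iff φ (p + 2) rfl hφ p rfl).1 (h _)
  · obtain ⟨φ, hφ, rfl⟩ := P.extMk_surjective e (p + 2) rfl
    exact (P.extMk_eq_zero_iff φ (p + 2) rfl hφ p rfl).2 (h φ hφ)

theorem vanishes_iff_isZero_H (p : ℕ) (W : FIMod.{u}) (T : FB) :
    Vanishes p W (FB.toFI.obj T) ↔ IsZero (((H p).obj W).obj T) := by
  cases p with
  | zero =>
    rw [vanishes_zero_iff_isZero_H₀]
    exact (((evaluation FB AddCommGrpCat).obj T).mapIso
      (H₀.leftDerivedZeroIsoSelf.app W)).isZero_iff.symm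
  | succ p =>
    let P := projectiveResolution W
    let K := (H₀.mapHomologicalComplex _).obj P.complex
    let E := (evaluation FB AddCommGrpCat.{u}).obj T
    rw [vanishes_succ_iff_exact P, ShortComplex.exact_iff_isZero_homology]
    refine Iso.isZero_iff ?_
    -- Evaluation at `T` is exact, so it commutes with homology.
    exact ShortComplex.mapHomologyIso (K.sc' (p + 2) (p + 1) p) E ≪≫
      E.mapIso (ShortComplex.homologyMapIso (K.isoSc' (p + 2) (p + 1) p (by simp) (by simp))).symm ≪≫
      E.mapIso (P.isoLeftDerivedObj H₀ (p + 1)).symm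


/-! ### The shift functor, its kernel and its cokernel -/

/-- The shift `W ↦ W_{T ⊔ *}`. -/
abbrev shift : FIMod.{u} ⥤ FIMod.{u} := (Functor.whiskeringLeft _ _ _).obj FI.plus

/-- The morphism from `W` to its shift. -/
def shiftι (W : FIMod.{u}) : W ⟶ shift.obj W := Functor.whiskerRight FI.incl W

lemma shiftι_naturality {X Y : FIMod.{u}} (f : X ⟶ Y) :
    shiftι X ≫ shift.map f = f ≫ shiftι Y := by
  ext T : 2
  exact f.naturality _

/-- The kernel of the morphism from `W` to its shift. -/
noncomputable abbrev K (W : FIMod.{u}) : FIMod.{u} := kernel (shiftι W)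

/-- The derivative of `W`: the cokernel of the morphism from `W` to its shift. -/
noncomputable abbrev D (W : FIMod.{u}) : FIMod.{u} := cokernel (shiftι W)

/-- The projection from the shift of `W` to its derivative. -/
noncomputable abbrev Dπ (W : FIMod.{u}) : shift.obj W ⟶ D W := cokernel.π (shiftι W)

/-- The morphism of derivatives induced by `f`. -/
noncomputable abbrev Dmap {X Y : FIMod.{u}} (f : X ⟶ Y) : D X ⟶ D Y :=
  cokernel.map _ _ f (shift.map f) (shiftι_naturality f)

/-- The morphism of kernels induced by `f`. -/
noncomputable abbrev Kmap {X Y : FIMod.{u}} (f : X ⟶ Y) : K X ⟶ K Y :=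
  kernel.map _ _ f (shift.map f) (shiftι_naturality f)

lemma map_incl_comp_Dπ_app (W : FIMod.{u}) (T : FI) :
    W.map (FI.incl.app T) ≫ (Dπ W).app T = 0 :=
  congrArg (fun k => NatTrans.app k T) (cokernel.condition (shiftι W))

lemma kernelι_app_comp_map_incl (W : FIMod.{u}) (T : FI) :
    (kernel.ι (shiftι W)).app T ≫ W.map (FI.incl.app T) = 0 :=
  congrArg (fun k => NatTrans.app k T) (kernel.condition (shiftι W))

lemma Dπ_app_comp_map (W : FIMod.{u}) {R T : FI} (r : R ⟶ T) :
    (Dπ W).app R ≫ (D W).map r = W.map (FI.plus.map r) ≫ (Dπ W).app T :=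
  ((Dπ W).naturality r).symm

lemma exists_Dπ_app_comp (W : FIMod.{u}) (T : FI) {A : AddCommGrpCat.{u}}
    (α : W.obj (FI.plus.obj T) ⟶ A) (hα : W.map (FI.incl.app T) ≫ α = 0) :
    ∃ β : (D W).obj T ⟶ A, (Dπ W).app T ≫ β = α := by
  let S := ShortComplex.mk _ _ (cokernel.condition (shiftι W))
  have hS : S.Exact := ShortComplex.exact_cokernel _
  have hE := hS.map ((evaluation FI AddCommGrpCat).obj T)
  have : Epi (S.map ((evaluation FI AddCommGrpCat).obj T)).g :=
    (inferInstance : Epi ((Dπ W).app T))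
  exact ⟨hE.desc α hα, hE.g_desc α hα⟩

/-- If `f` hits the added point, it is, up to a bijection, the extension of a non-bijection into
`T`, which `φ` already kills. Otherwise `f` factors through `FI.incl`, whose image dies in `D X`. -/
lemma map_comp_Dπ_comp_coindEval {X : FIMod.{u}} (φ : D X ⟶ coind T A) (R : FI)
    (f : R ⟶ FI.plus.obj T) (hf : ¬ FI.IsBij f) :
    X.map f ≫ (Dπ X).app T ≫ φ.app T ≫ coindEval T A = 0 := by
  by_cases h : ∃ s, FI.toEmbedding f s = (none : Option T.carrier)
  · obtain ⟨s, hs⟩ := h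
    rw [← FI.split_comp_restr f s hs, X.map_comp, Category.assoc,
      ← Category.assoc (X.map (FI.plus.map _)), ← Dπ_app_comp_map, Category.assoc,
      map_comp_coindEval φ, comp_zero, comp_zero]
    intro hr
    rw [← FI.isBij_plus_iff, ← FI.isBij_comp_iff _ _ (FI.isBij_split R s),
      FI.split_comp_restr] at hr
    exact hf hr
  · rw [← FI.corestr_comp_incl f fun s hs => h ⟨s, hs⟩, X.map_comp, Category.assoc,
      ← Category.assoc (X.map (FI.incl.app T)), map_incl_comp_Dπ_app, zero_comp, comp_zero]

/-- Morphisms from the derivative to a module coinduced at `T` are the morphisms to the module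
coinduced at `T` with a point added. -/
noncomputable def derivEquiv (T : FI) (X : FIMod.{u}) (A : AddCommGrpCat.{u}) :
    (D X ⟶ coind T A) ≃ (X ⟶ coind (FI.plus.obj T) A) :=
  Equiv.ofBijective (fun φ => coindLift _ (map_comp_Dπ_comp_coindEval φ)) (by
    constructor
    · intro φ φ' h
      refine coind_hom_ext ?_
      rw [← cancel_epi ((Dπ X).app T), ← coindLift_app_eval _ (map_comp_Dπ_comp_coindEval φ),
        ← coindLift_app_eval _ (map_comp_Dπ_comp_coindEval φ')]
      exact congrArg (fun k => NatTrans.app k _ ≫ _) h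
    · intro ψ
      obtain ⟨β, hβ⟩ := exists_Dπ_app_comp X T (ψ.app _ ≫ coindEval _ A)
        (map_comp_coindEval ψ _ (FI.not_isBij_incl T))
      refine ⟨coindLift β fun R f hf => ?_, coind_hom_ext ?_⟩
      · rw [← cancel_epi ((Dπ X).app R), ← Category.assoc, Dπ_app_comp_map, Category.assoc, hβ,
          map_comp_coindEval ψ _ (by rwa [FI.isBij_plus_iff]), comp_zero]
      · rw [coindLift_app_eval, coindLift_app_eval, hβ])

lemma derivEquiv_app_eval {X : FIMod.{u}} (φ : D X ⟶ coind T A) :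
    (derivEquiv T X A φ).app _ ≫ coindEval _ A = (Dπ X).app T ≫ φ.app T ≫ coindEval T A :=
  coindLift_app_eval _ (map_comp_Dπ_comp_coindEval φ)

lemma derivEquiv_naturality {X Y : FIMod.{u}} (f : X ⟶ Y) (φ : D Y ⟶ coind T A) :
    derivEquiv T X A (Dmap f ≫ φ) = f ≫ derivEquiv T Y A φ := by
  refine coind_hom_ext ?_
  have h' : Dπ X ≫ Dmap f = shift.map f ≫ Dπ Y := cokernel.π_desc _ _ _
  have h : (Dπ X).app T ≫ (Dmap f).app T = f.app (FI.plus.obj T) ≫ (Dπ Y).app T :=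
    congrArg (fun k => NatTrans.app k T) h'
  rw [derivEquiv_app_eval, NatTrans.comp_app, NatTrans.comp_app, Category.assoc, Category.assoc,
    derivEquiv_app_eval, ← Category.assoc, h, Category.assoc]

/-! ### The shift of a free module -/

lemma shiftFree_hom_ext {S : FI} {N : FIMod.{u}} {φ ψ : shift.obj (free S) ⟶ N}
    (h : ∀ (T : FI) (g : S ⟶ FI.plus.obj T),
      (φ.app T).hom (freeOf g) = (ψ.app T).hom (freeOf g)) : φ = ψ := by
  refine NatTrans.ext (funext fun T => AddCommGrpCat.hom_ext
    (FreeAbelianGroup.lift_ext _ _ ?_))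
  rintro ⟨g⟩
  exact h T g

/-- The morphism from the shift of a free module given by a natural family of elements. -/
noncomputable def shiftFreeDesc {S : FI} {N : FIMod.{u}}
    (y : ∀ T : FI, (S ⟶ FI.plus.obj T) → N.obj T)
    (hy : ∀ (T T' : FI) (k : T ⟶ T') (g : S ⟶ FI.plus.obj T),
      y T' (g ≫ FI.plus.map k) = (N.map k).hom (y T g)) : shift.obj (free S) ⟶ N where
  app T := AddCommGrpCat.ofHom
    (FreeAbelianGroup.lift fun g : ULift.{u} (S ⟶ FI.plus.obj T) => y T g.down)
  naturality T T' k := by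
    refine AddCommGrpCat.hom_ext (FreeAbelianGroup.lift_ext _ _ fun g => ?_)
    refine (congrArg (FreeAbelianGroup.lift _) (FreeAbelianGroup.map_of_apply _)).trans ?_
    refine (FreeAbelianGroup.lift_apply_of _ _).trans ?_
    refine Eq.trans ?_ (congrArg (N.map k).hom (FreeAbelianGroup.lift_apply_of _ _)).symm
    exact hy _ _ _ _

lemma shiftFreeDesc_app_freeOf {S : FI} {N : FIMod.{u}}
    (y : ∀ T : FI, (S ⟶ FI.plus.obj T) → N.obj T)
    (hy : ∀ (T T' : FI) (k : T ⟶ T') (g : S ⟶ FI.plus.obj T),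
      y T' (g ≫ FI.plus.map k) = (N.map k).hom (y T g)) (T : FI) (g : S ⟶ FI.plus.obj T) :
    ((shiftFreeDesc y hy).app T).hom (freeOf g) = y T g :=
  FreeAbelianGroup.lift_apply_of _ _

open Classical in
/-- The values on generators of the retraction of the shift of a free module. -/
noncomputable def retrVal (S T : FI) (g : S ⟶ FI.plus.obj T) : (free.{u} S).obj T :=
  -- Injections hitting the added point span a complement to the image of the free module, and the
  -- retraction kills them.
  if h : ∀ s, FI.toEmbedding g s ≠ (none : Option T.carrier) then freeOf (FI.corestr g h) else 0

lemma retrVal_incl (S T : FI) (g : S ⟶ T) :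
    retrVal.{u} S T (g ≫ FI.incl.app T) = freeOf g := by
  have h : ∀ s, FI.toEmbedding (g ≫ FI.incl.app T) s ≠ (none : Option T.carrier) :=
    fun s hs => by cases hs
  rw [retrVal, dif_pos h]
  refine congrArg freeOf (FI.hom_ext fun s => Option.some_injective _ ?_)
  exact FI.some_corestr _ h s

lemma retrVal_of_eq_none (S T : FI) (g : S ⟶ FI.plus.obj T) (s : S.carrier)
    (hs : FI.toEmbedding g s = (none : Option T.carrier)) : retrVal.{u} S T g = 0 :=
  dif_neg fun h => h s hs

/-- The retraction of the shift of a free module on the free module. -/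
noncomputable def freeRetr (S : FI) : shift.obj (free.{u} S) ⟶ free S :=
  shiftFreeDesc (retrVal S) fun T T' k g => by
    by_cases h : ∃ s, FI.toEmbedding g s = (none : Option T.carrier)
    · obtain ⟨s, hs⟩ := h
      rw [retrVal_of_eq_none S T g s hs, map_zero, retrVal_of_eq_none S T' _ s]
      rw [FI.toEmbedding_comp, hs]
      rfl
    · rw [← FI.corestr_comp_incl g fun s hs => h ⟨s, hs⟩, retrVal_incl, free_map_freeOf,
        ← retrVal_incl, Category.assoc, Category.assoc]
      rfl

lemma shiftι_free_comp_freeRetr (S : FI) : shiftι (free.{u} S) ≫ freeRetr S = 𝟙 _ := by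
  refine free_hom_ext ?_
  have h : ((shiftι (free.{u} S)).app S).hom (freeOf (𝟙 S)) = freeOf (𝟙 S ≫ FI.incl.app S) :=
    free_map_freeOf _ _
  refine (congrArg ((freeRetr S).app S).hom h).trans ?_
  exact (shiftFreeDesc_app_freeOf _ _ _ _).trans (retrVal_incl S S (𝟙 S))

open Classical in
/-- The values on generators of a morphism from the derivative of a free module. -/
noncomputable def derivVal {S : FI} {N : FIMod.{u}} (y : ∀ s : S.carrier, N.obj (FI.del S s))
    (T : FI) (g : S ⟶ FI.plus.obj T) : N.obj T :=
  if h : ∃ s, FI.toEmbedding g s = (none : Option T.carrier) then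
    (N.map (FI.restr g h.choose h.choose_spec)).hom (y h.choose) else 0

lemma derivVal_of_eq_none {S : FI} {N : FIMod.{u}} (y : ∀ s : S.carrier, N.obj (FI.del S s))
    (T : FI) (g : S ⟶ FI.plus.obj T) (s : S.carrier)
    (hs : FI.toEmbedding g s = (none : Option T.carrier)) :
    derivVal y T g = (N.map (FI.restr g s hs)).hom (y s) := by
  have h : ∃ s, FI.toEmbedding g s = (none : Option T.carrier) := ⟨s, hs⟩
  have key : ∀ (s' : S.carrier) (hs' : FI.toEmbedding g s' = (none : Option T.carrier)),
      s' = s → (N.map (FI.restr g s' hs')).hom (y s') = (N.map (FI.restr g s hs)).hom (y s) := by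
    rintro s' hs' rfl
    rfl
  rw [derivVal, dif_pos h]
  -- The chosen preimage of the added point is `s`, because `g` is injective.
  exact key _ _ ((FI.toEmbedding g).injective (h.choose_spec.trans hs.symm))

lemma derivVal_incl {S : FI} {N : FIMod.{u}} (y : ∀ s : S.carrier, N.obj (FI.del S s))
    (T : FI) (g : S ⟶ T) : derivVal y T (g ≫ FI.incl.app T) = 0 :=
  dif_neg fun ⟨_, hs⟩ => by cases hs

/-- The morphism from the shift of a free module given by elements at the complements of points. -/
noncomputable def derivFreeDesc {S : FI} {N : FIMod.{u}}
    (y : ∀ s : S.carrier, N.obj (FI.del S s)) : shift.obj (free S) ⟶ N :=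
  shiftFreeDesc (derivVal y) fun T T' k g => by
    by_cases h : ∃ s, FI.toEmbedding g s = (none : Option T.carrier)
    · obtain ⟨s, hs⟩ := h
      have hs' : FI.toEmbedding (g ≫ FI.plus.map k) s = (none : Option T'.carrier) := by
        rw [FI.toEmbedding_comp, hs]
        rfl
      rw [derivVal_of_eq_none y T g s hs, derivVal_of_eq_none y T' _ s hs',
        FI.restr_comp g k s hs hs', N.map_comp]
      rfl
    · rw [← FI.corestr_comp_incl g fun s hs => h ⟨s, hs⟩, derivVal_incl, map_zero,
        Category.assoc]
      exact derivVal_incl y T' (_ ≫ k)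

lemma shiftι_free_comp_derivFreeDesc {S : FI} {N : FIMod.{u}}
    (y : ∀ s : S.carrier, N.obj (FI.del S s)) : shiftι (free S) ≫ derivFreeDesc y = 0 := by
  refine free_hom_ext ?_
  have h : ((shiftι (free.{u} S)).app S).hom (freeOf (𝟙 S)) = freeOf (𝟙 S ≫ FI.incl.app S) :=
    free_map_freeOf _ _
  refine (congrArg ((derivFreeDesc y).app S).hom h).trans ?_
  exact (shiftFreeDesc_app_freeOf _ _ _ _).trans (derivVal_incl y S (𝟙 S))

/-- In effect `D (free S)` is the sum of the free modules on `S ∖ {s}`: an injection hitting the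
added point at `s` amounts to an injection of `S ∖ {s}`. A lift is therefore fixed by its values on
the generators `FI.split S s`. -/
instance (S : FI) : Projective (D (free.{u} S)) where
  factors {E X} f e _ := by
    have H (s : S.carrier) : ∃ y : E.obj (FI.del S s), (e.app _).hom y =
        ((Dπ (free S) ≫ f).app (FI.del S s)).hom (freeOf (FI.split S s)) :=
      (AddCommGrpCat.epi_iff_surjective (e.app (FI.del S s))).1 inferInstance _
    choose y hy using H
    refine ⟨cokernel.desc _ (derivFreeDesc y) (shiftι_free_comp_derivFreeDesc y), ?_⟩
    rw [← cancel_epi (Dπ _), cokernel.π_desc_assoc]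
    refine shiftFree_hom_ext fun T g => ?_
    refine (congrArg (e.app T).hom (shiftFreeDesc_app_freeOf _ _ T g)).trans ?_
    by_cases h : ∃ s, FI.toEmbedding g s = (none : Option T.carrier)
    · obtain ⟨s, hs⟩ := h
      rw [derivVal_of_eq_none y T g s hs]
      refine (congrArg (fun k => k.hom (y s)) (e.naturality (FI.restr g s hs))).trans ?_
      refine (congrArg (X.map (FI.restr g s hs)).hom (hy s)).trans ?_
      refine (congrArg (fun k => k.hom (freeOf (FI.split S s)))
        ((Dπ (free S) ≫ f).naturality (FI.restr g s hs))).symm.trans ?_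
      refine congrArg ((Dπ (free S) ≫ f).app T).hom ((free_map_freeOf _ _).trans ?_)
      rw [FI.split_comp_restr]
    · rw [← FI.corestr_comp_incl g fun s hs => h ⟨s, hs⟩, derivVal_incl, map_zero,
        ← free_map_freeOf]
      have h0 : (free.{u} S).map (FI.incl.app T) ≫ (Dπ (free S) ≫ f).app T = 0 := by
        rw [NatTrans.comp_app, ← Category.assoc, map_incl_comp_Dπ_app, zero_comp]
      exact (congrArg (fun k : (free.{u} S).obj T ⟶ X.obj T =>
        k.hom (freeOf (FI.corestr g fun s hs => h ⟨s, hs⟩))) h0).symm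


/-! ### Free presentations -/

section Coproduct

variable {ι : Type u} (S : ι → FI)

/-- The coproduct of a family of free modules. -/
noncomputable abbrev freeSum : FIMod.{u} := ∐ fun i => free.{u} (S i)

/-- The inclusion of a summand. -/
noncomputable abbrev freeSumι (i : ι) : free.{u} (S i) ⟶ freeSum S :=
  Sigma.ι (fun i => free.{u} (S i)) i

instance : Projective (freeSum.{u} S) where
  factors f e _ := ⟨Sigma.desc fun i => Projective.factorThru (freeSumι S i ≫ f) e,
    Sigma.hom_ext _ _ fun i => by
      rw [← Category.assoc, Sigma.ι_desc, Projective.factorThru_comp]⟩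

/-- The shift of a coproduct of free modules is the coproduct of the shifts. -/
noncomputable def shiftFreeSumIsColimit :
    IsColimit (Cofan.mk (shift.obj (freeSum.{u} S)) fun i => shift.map (freeSumι S i)) :=
  isColimitCofanMkObjOfIsColimit shift _ _ (coproductIsCoproduct _)

lemma shiftFreeSum_hom_ext {N : FIMod.{u}} {φ ψ : shift.obj (freeSum S) ⟶ N}
    (h : ∀ i, shift.map (freeSumι S i) ≫ φ = shift.map (freeSumι S i) ≫ ψ) : φ = ψ :=
  Cofan.IsColimit.hom_ext (shiftFreeSumIsColimit S) _ _ h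

/-- The morphism from the shift of a coproduct of free modules given by its components. -/
noncomputable def shiftFreeSumDesc {N : FIMod.{u}} (k : ∀ i, shift.obj (free (S i)) ⟶ N) :
    shift.obj (freeSum S) ⟶ N :=
  Cofan.IsColimit.desc (shiftFreeSumIsColimit S) k

lemma map_comp_shiftFreeSumDesc {N : FIMod.{u}} (k : ∀ i, shift.obj (free (S i)) ⟶ N) (i : ι) :
    shift.map (freeSumι S i) ≫ shiftFreeSumDesc S k = k i :=
  Cofan.IsColimit.fac (shiftFreeSumIsColimit S) k i

instance : Mono (shiftι (freeSum.{u} S)) := by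
  have h : shiftι (freeSum S) ≫ shiftFreeSumDesc S (fun i => freeRetr (S i) ≫ freeSumι S i) =
      𝟙 _ := by
    refine Sigma.hom_ext _ _ fun i => ?_
    rw [← Category.assoc, ← shiftι_naturality, Category.assoc, map_comp_shiftFreeSumDesc,
      ← Category.assoc, shiftι_free_comp_freeRetr, Category.id_comp, Category.comp_id]
  exact mono_of_mono_fac h

instance : Projective (D (freeSum.{u} S)) where
  factors {E X} f e _ := by
    let k (i : ι) : D (free (S i)) ⟶ E := Projective.factorThru (Dmap (freeSumι S i) ≫ f) e
    have hk : shiftι (freeSum S) ≫ shiftFreeSumDesc S (fun i => Dπ _ ≫ k i) = 0 := by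
      refine Sigma.hom_ext _ _ fun i => ?_
      rw [← Category.assoc, ← shiftι_naturality, Category.assoc, map_comp_shiftFreeSumDesc,
        cokernel.condition_assoc, zero_comp, comp_zero]
    refine ⟨cokernel.desc _ _ hk, ?_⟩
    rw [← cancel_epi (Dπ _), cokernel.π_desc_assoc]
    refine shiftFreeSum_hom_ext S fun i => ?_
    rw [← Category.assoc, map_comp_shiftFreeSumDesc, Category.assoc, Projective.factorThru_comp,
      cokernel.π_desc_assoc, Category.assoc]

end Coproduct

/-- Every module is a quotient of a projective module that embeds in its shift and whose derivative
is projective. -/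
theorem exists_presentation (W : FIMod.{u}) : ∃ (P : FIMod.{u}) (π : P ⟶ W),
    Projective P ∧ Mono (shiftι P) ∧ Projective (D P) ∧ Epi π := by
  -- Using only the sets `Fin n` keeps the index type in universe `u`; every finite set is
  -- isomorphic to one of them.
  let S : (Σ n : ℕ, W.obj ⟨Fin n⟩) → FI := fun i => ⟨Fin i.1⟩
  let π : freeSum S ⟶ W := Sigma.desc fun i => freeDesc i.2
  have (T : FI) : Epi (π.app T) := by
    rw [AddCommGrpCat.epi_iff_surjective]
    intro y
    let e := FI.isoOfEquiv (S := T) (T := ⟨Fin (Nat.card T.carrier)⟩) (Finite.equivFin T.carrier)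
    let i : Σ n : ℕ, W.obj ⟨Fin n⟩ := ⟨Nat.card T.carrier, (W.map e.hom).hom y⟩
    refine ⟨((freeSumι S i).app T).hom (freeOf e.inv), ?_⟩
    have h1 : freeSumι S i ≫ π = freeDesc i.2 := Sigma.ι_desc _ _
    have h2 := freeDesc_app_freeOf i.2 e.inv
    rw [← h1] at h2
    refine h2.trans ?_
    change ((W.map e.hom ≫ W.map e.inv).hom) y = y
    rw [← W.map_comp, e.hom_inv_id, W.map_id]
    rfl
  exact ⟨freeSum S, π, inferInstance, inferInstance, inferInstance, NatTrans.epi_of_epi_app π⟩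

/-! ### The snake sequence -/

lemma mono_shiftι_of_mono {X Y : FIMod.{u}} (f : X ⟶ Y) [Mono f] [Mono (shiftι Y)] :
    Mono (shiftι X) := by
  have : Mono (shiftι X ≫ shift.map f) := by
    rw [shiftι_naturality]
    infer_instance
  exact mono_of_mono _ (shift.map f)

/-- The snake diagram of a short exact sequence and its shift. -/
noncomputable def shiftSnake {S : ShortComplex FIMod.{u}} (hS : S.ShortExact) :
    ShortComplex.SnakeInput FIMod.{u} where
  L₀ := ShortComplex.mk (Kmap S.f) (Kmap S.g) (by
    rw [← cancel_mono (kernel.ι _)]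
    simp)
  L₁ := S
  L₂ := S.map shift
  L₃ := ShortComplex.mk (Dmap S.f) (Dmap S.g) (by
    rw [← cancel_epi (cokernel.π _), cokernel.π_desc_assoc, Category.assoc, cokernel.π_desc,
      ← Category.assoc, ← Functor.map_comp, S.zero, Functor.map_zero, zero_comp, comp_zero])
  v₀₁ := { τ₁ := kernel.ι _, τ₂ := kernel.ι _, τ₃ := kernel.ι _ }
  v₁₂ := { τ₁ := shiftι _, τ₂ := shiftι _, τ₃ := shiftι _,
           comm₁₂ := shiftι_naturality _, comm₂₃ := shiftι_naturality _ }
  v₂₃ := { τ₁ := cokernel.π _, τ₂ := cokernel.π _, τ₃ := cokernel.π _,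
           comm₁₂ := cokernel.π_desc _ _ _, comm₂₃ := cokernel.π_desc _ _ _ }
  w₀₂ := by
    ext : 1 <;> exact kernel.condition _
  w₁₃ := by
    ext : 1 <;> exact cokernel.condition _
  h₀ := by
    apply ShortComplex.isLimitOfIsLimitπ
    all_goals exact (KernelFork.isLimitMapConeEquiv _ _).symm (kernelIsKernel _)
  h₃ := by
    apply ShortComplex.isColimitOfIsColimitπ
    all_goals exact (CokernelCofork.isColimitMapCoconeEquiv _ _).symm (cokernelIsCokernel _)
  L₁_exact := hS.exact
  epi_L₁_g := hS.epi_g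
  L₂_exact := hS.exact.map shift
  mono_L₂_f := by
    have := hS.mono_f
    exact (inferInstance : Mono (shift.map S.f))

/-- If `0 → W' → P → W → 0` is exact and `P` embeds in its shift, then the morphism `D W' ⟶ D P` has
kernel `K W` and cokernel `D W`. -/
theorem exists_deriv_sequences {S : ShortComplex FIMod.{u}} (hS : S.ShortExact)
    [Mono (shiftι S.X₂)] :
    ∃ (I : FIMod.{u}) (j : K S.X₃ ⟶ D S.X₁) (q : D S.X₁ ⟶ I) (i : I ⟶ D S.X₂)
      (w₁ : j ≫ q = 0) (w₂ : i ≫ Dmap S.g = 0), q ≫ i = Dmap S.f ∧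
      (ShortComplex.mk j q w₁).ShortExact ∧ (ShortComplex.mk i (Dmap S.g) w₂).ShortExact := by
  have := hS.epi_g
  have : Epi (shift.map S.g) := inferInstance
  have : Epi (Dmap S.g) := epi_of_epi_fac (cokernel.π_desc (shiftι S.X₂) _ _)
  obtain ⟨δ, w, _, e₁⟩ : ∃ (δ : K S.X₃ ⟶ D S.X₁) (w : δ ≫ Dmap S.f = 0), Mono δ ∧
      (ShortComplex.mk δ (Dmap S.f) w).Exact := by
    -- The middle kernel vanishes, so the connecting morphism is mono. The sequence `0 → K W → D W'
    -- → D P → D W → 0` is then cut at the image of its middle map.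
    have h0 : IsZero (shiftSnake hS).L₀.X₂ := isZero_kernel_of_mono (shiftι S.X₂)
    exact ⟨(shiftSnake hS).δ, (shiftSnake hS).δ_L₃_f,
      (shiftSnake hS).L₁'_exact.mono_g (h0.eq_of_src _ _), (shiftSnake hS).L₂'_exact⟩
  obtain ⟨w', e₂⟩ : ∃ w : Dmap S.f ≫ Dmap S.g = 0, (ShortComplex.mk _ _ w).Exact :=
    ⟨(shiftSnake hS).L₃.zero, (shiftSnake hS).L₃_exact⟩
  have w₁ : δ ≫ Abelian.factorThruImage (Dmap S.f) = 0 := by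
    rw [← cancel_mono (Abelian.image.ι _), Category.assoc, Abelian.image.fac, zero_comp, w]
  have w₂ : Abelian.image.ι (Dmap S.f) ≫ Dmap S.g = 0 := by
    rw [← cancel_epi (Abelian.factorThruImage _), ← Category.assoc, Abelian.image.fac, comp_zero,
      w']
  refine ⟨_, δ, _, _, w₁, w₂, Abelian.image.fac _, ?_, ?_⟩
  · refine { exact := ?_, mono_f := inferInstance, epi_g := inferInstance }
    let φ : ShortComplex.mk δ (Abelian.factorThruImage (Dmap S.f)) w₁ ⟶
      ShortComplex.mk δ (Dmap S.f) w :=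
      { τ₁ := 𝟙 _, τ₂ := 𝟙 _, τ₃ := Abelian.image.ι _
        comm₂₃ := (Category.id_comp _).trans (Abelian.image.fac _).symm }
    have : Epi φ.τ₁ := inferInstanceAs (Epi (𝟙 _))
    have : IsIso φ.τ₂ := inferInstanceAs (IsIso (𝟙 _))
    have : Mono φ.τ₃ := inferInstanceAs (Mono (Abelian.image.ι (Dmap S.f)))
    exact (ShortComplex.exact_iff_of_epi_of_isIso_of_mono φ).2 e₁
  · refine { exact := ?_, mono_f := inferInstance, epi_g := inferInstance }
    let φ : ShortComplex.mk (Dmap S.f) (Dmap S.g) w' ⟶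
      ShortComplex.mk (Abelian.image.ι (Dmap S.f)) (Dmap S.g) w₂ :=
      { τ₁ := Abelian.factorThruImage (Dmap S.f), τ₂ := 𝟙 _, τ₃ := 𝟙 _
        comm₁₂ := (Abelian.image.fac _).trans (Category.comp_id _).symm
        comm₂₃ := (Category.id_comp _).trans (Category.comp_id _).symm }
    have : Epi φ.τ₁ := inferInstanceAs (Epi (Abelian.factorThruImage (Dmap S.f)))
    have : IsIso φ.τ₂ := inferInstanceAs (IsIso (𝟙 _))
    have : Mono φ.τ₃ := inferInstanceAs (Mono (𝟙 _))
    exact (ShortComplex.exact_iff_of_epi_of_isIso_of_mono φ).1 e₂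


/-! ### Extensions and the derivative -/

section Ext

variable {C : Type*} [Category* C] [Abelian C] [HasExt C] {S : ShortComplex C}

open Abelian

lemma exists_comp_eq_of_ext_one (hS : S.ShortExact) (N : C) (h : ∀ e : Ext S.X₃ N 1, e = 0)
    (f : S.X₁ ⟶ N) : ∃ g : S.X₂ ⟶ N, S.f ≫ g = f := by
  obtain ⟨x, hx⟩ := Ext.contravariant_sequence_exact₁ hS N (Ext.mk₀ f) (add_zero 1) (h _)
  obtain ⟨g, rfl⟩ := (Ext.mk₀_bijective _ _).2 x
  refine ⟨g, (Ext.mk₀_bijective _ _).1 ?_⟩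
  rw [← hx, Ext.mk₀_comp_mk₀]

lemma ext_one_left_eq_zero_iff (hS : S.ShortExact) [Projective S.X₂] (N : C) :
    (∀ e : Ext S.X₃ N 1, e = 0) ↔ ∀ f : S.X₁ ⟶ N, ∃ g : S.X₂ ⟶ N, S.f ≫ g = f := by
  refine ⟨exists_comp_eq_of_ext_one hS N, fun h e => ?_⟩
  obtain ⟨x, rfl⟩ := Ext.contravariant_sequence_exact₃ hS N e (Ext.eq_zero_of_projective _)
    (add_zero 1)
  obtain ⟨f, rfl⟩ := (Ext.mk₀_bijective _ _).2 x
  obtain ⟨g, rfl⟩ := h f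
  rw [← Ext.mk₀_comp_mk₀, hS.extClass_comp_assoc]

/-- Dimension shifting along a projective middle term. -/
lemma ext_succ_eq_zero_iff (hS : S.ShortExact) [Projective S.X₂] (N : C) (p : ℕ) :
    (∀ e : Ext S.X₃ N (p + 2), e = 0) ↔ ∀ e : Ext S.X₁ N (p + 1), e = 0 := by
  refine ⟨fun h e => ?_, fun h e => ?_⟩
  · obtain ⟨x, rfl⟩ := Ext.contravariant_sequence_exact₁ hS N e (n₁ := p + 2) (by omega) (h _)
    rw [Ext.eq_zero_of_projective x, Ext.comp_zero]
  · obtain ⟨x, rfl⟩ := Ext.contravariant_sequence_exact₃ hS N e (Ext.eq_zero_of_projective _)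
      (n₀ := p + 1) (by omega)
    rw [h x, Ext.comp_zero]

lemma ext_eq_zero_of_isZero {X : C} (hX : IsZero X) (N : C) (p : ℕ) (e : Ext X N p) : e = 0 := by
  rw [← Ext.mk₀_id_comp e, hX.eq_of_src (𝟙 X) 0, Ext.mk₀_zero, Ext.zero_comp]

lemma ext_middle_eq_zero (hS : S.ShortExact) (N : C) (p : ℕ) (h₁ : ∀ e : Ext S.X₁ N p, e = 0)
    (h₃ : ∀ e : Ext S.X₃ N p, e = 0) (e : Ext S.X₂ N p) : e = 0 := by
  obtain ⟨x, rfl⟩ := Ext.contravariant_sequence_exact₂ hS N e (h₁ _)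
  rw [h₃ x, Ext.comp_zero]

end Ext

/-! ### Fragments of the long exact sequence relating `W`, `K W` and `D W`. -/

lemma vanishes_zero_deriv {W : FIMod.{u}} (h : Vanishes 0 W (FI.plus.obj T)) :
    Vanishes 0 (D W) T := by
  rw [vanishes_zero_iff] at h ⊢
  intro A _ f
  exact (derivEquiv T W A).injective ((h A _).trans (h A _).symm)

/-- A short exact sequence with a projective middle term that embeds in its shift and whose
derivative is projective. -/
lemma exists_shortExact (W : FIMod.{u}) : ∃ (S : ShortComplex FIMod.{u}), S.ShortExact ∧
    S.X₃ = W ∧ Projective S.X₂ ∧ Mono (shiftι S.X₂) ∧ Projective (D S.X₂) := by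
  obtain ⟨P, π, h₁, h₂, h₃, h₄⟩ := exists_presentation W
  exact ⟨ShortComplex.mk (kernel.ι π) π (kernel.condition π),
    { exact := ShortComplex.exact_of_f_is_kernel _ (kernelIsKernel π) }, rfl, h₁, h₂, h₃⟩

/-- Dual to the surjection `H₁(W)_{T ⊔ *} → H₁(D W)_T`. A morphism on `I` is pulled back to `D W'`,
extended to `D P` through `derivEquiv`, and compared after cancelling the epimorphism `q`. -/
theorem vanishes_one_deriv {W : FIMod.{u}} (h : Vanishes 1 W (FI.plus.obj T)) :
    Vanishes 1 (D W) T := by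
  obtain ⟨S, hS, rfl, _, _, _⟩ := exists_shortExact W
  obtain ⟨I, j, q, i, w₁, w₂, hqi, h₁, h₂⟩ := exists_deriv_sequences hS
  intro A _
  have hp : Projective (ShortComplex.mk i (Dmap S.g) w₂).X₂ := ‹Projective (D S.X₂)›
  refine (ext_one_left_eq_zero_iff h₂ _).2 fun f => ?_
  obtain ⟨g, hg⟩ := (ext_one_left_eq_zero_iff hS _).1 (h A) (derivEquiv T _ A (q ≫ f))
  obtain ⟨g, rfl⟩ := (derivEquiv T _ A).surjective g
  rw [← derivEquiv_naturality, EmbeddingLike.apply_eq_iff_eq, ← hqi, Category.assoc] at hg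
  have := h₁.epi_g
  exact ⟨g, (cancel_epi q).1 hg⟩

/-- Dual to exactness of `H₂(D W)_T → H₀(K W)_T → H₁(W)_{T ⊔ *}`. A morphism on `K W` extends to `D
W'` by the hypothesis on `D W`, and then to `D P` by the one on `W`; the composite `K W → D W' → D
P` is zero. -/
theorem vanishes_zero_K {W : FIMod.{u}} (h : Vanishes 1 W (FI.plus.obj T))
    (hD : Vanishes 2 (D W) T) : Vanishes 0 (K W) T := by
  obtain ⟨S, hS, rfl, _, _, _⟩ := exists_shortExact W
  obtain ⟨I, j, q, i, w₁, w₂, hqi, h₁, h₂⟩ := exists_deriv_sequences hS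
  rw [vanishes_zero_iff]
  intro A _ f
  have hp : Projective (ShortComplex.mk i (Dmap S.g) w₂).X₂ := ‹Projective (D S.X₂)›
  obtain ⟨f', hf'⟩ := exists_comp_eq_of_ext_one h₁ _ ((ext_succ_eq_zero_iff h₂ _ 0).1 (hD A)) f
  obtain ⟨g, hg⟩ := (ext_one_left_eq_zero_iff hS _).1 (h A) (derivEquiv T _ A f')
  obtain ⟨g, rfl⟩ := (derivEquiv T _ A).surjective g
  rw [← derivEquiv_naturality, EmbeddingLike.apply_eq_iff_eq, ← hqi, Category.assoc] at hg
  rw [← hf', ← hg]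
  exact (reassoc_of% w₁) _ |>.trans zero_comp

/-- Dual to exactness of `H_p(K W)_T → H_{p+1}(W)_{T ⊔ *} → H_{p+1}(D W)_T`, by passing to the
syzygy. -/
theorem vanishes_succ_plus (p : ℕ) {W : FIMod.{u}} (hK : Vanishes p (K W) T)
    (hD : Vanishes (p + 1) (D W) T) : Vanishes (p + 1) W (FI.plus.obj T) := by
  induction p generalizing W with
  | zero =>
    obtain ⟨S, hS, rfl, _, _, _⟩ := exists_shortExact W
    obtain ⟨I, j, q, i, w₁, w₂, hqi, h₁, h₂⟩ := exists_deriv_sequences hS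
    intro A _
    refine (ext_one_left_eq_zero_iff hS _).2 fun f => ?_
    obtain ⟨f, rfl⟩ := (derivEquiv T _ A).surjective f
    have := h₁.epi_g
    obtain ⟨f', hf'⟩ : ∃ f', q ≫ f' = f :=
      ⟨h₁.exact.desc f ((vanishes_zero_iff _ _).1 hK A _), h₁.exact.g_desc _ _⟩
    obtain ⟨g, hg⟩ := exists_comp_eq_of_ext_one h₂ _ (hD A) f'
    refine ⟨derivEquiv T _ A g, ?_⟩
    rw [← derivEquiv_naturality, ← hqi, Category.assoc, ← hf']
    exact congrArg (fun k => derivEquiv T _ A (q ≫ k)) hg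
  | succ p ih =>
    obtain ⟨S, hS, rfl, _, _, _⟩ := exists_shortExact W
    obtain ⟨I, j, q, i, w₁, w₂, hqi, h₁, h₂⟩ := exists_deriv_sequences hS
    have hp : Projective (ShortComplex.mk i (Dmap S.g) w₂).X₂ := ‹Projective (D S.X₂)›
    intro A hA
    refine (ext_succ_eq_zero_iff hS _ p).2 (@ih S.X₁ ?_ ?_ A hA)
    -- The syzygy embeds in `P`, so it too has zero `K`, and only its derivative matters.
    · have := hS.mono_f
      have := mono_shiftι_of_mono S.f
      exact fun A _ => ext_eq_zero_of_isZero (isZero_kernel_of_mono (shiftι S.X₁)) _ _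
    · exact fun A _ => ext_middle_eq_zero h₁ _ (p + 1) (hK A)
        ((ext_succ_eq_zero_iff h₂ _ p).1 (hD A))

end FIMod

namespace FI

/-- The standard finite set with `n` elements. -/
def pt : ℕ → FI
  | 0 => ⟨Empty⟩
  | n + 1 => plus.obj (pt n)

lemma card_pt (n : ℕ) : Nat.card (pt n).carrier = n := by
  induction n with
  | zero => exact Nat.card_of_isEmpty (α := Empty)
  | succ n ih => exact Finite.card_option.trans (congrArg (· + 1) ih)

/-- A finite set with `n` elements is equivalent to the standard one. -/
noncomputable def equivPt {α : Type} [Finite α] {n : ℕ} (h : Nat.card α = n) :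
    α ≃ (pt n).carrier :=
  (Finite.equivFinOfCardEq h).trans (Finite.equivFinOfCardEq (card_pt n)).symm

lemma nonempty_iso_pt {T : FI} {n : ℕ} (h : Nat.card T.carrier = n) : Nonempty (T ≅ pt n) :=
  ⟨isoOfEquiv (equivPt h)⟩

lemma card_lt_of_not_isBij {R T : FI} (f : R ⟶ T) (hf : ¬ IsBij f) :
    Nat.card R.carrier < Nat.card T.carrier := by
  by_contra! h
  exact hf ((toEmbedding f).injective.bijective_of_nat_card_le h)

end FI

/-! ### Vanishing ranges by induction on cardinality. -/

namespace FIMod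

variable {T : FI} {W : FIMod.{u}}

lemma vanishes_zero_of_isZero (h : IsZero (W.obj T)) : Vanishes 0 W T :=
  (vanishes_zero_iff W T).2 fun _ _ _ => coind_hom_ext (h.eq_of_src _ _)

lemma isZero_obj_of_vanishes_zero (h : Vanishes 0 W T)
    (hW : ∀ (R : FI) (f : R ⟶ T), ¬ FI.IsBij f → W.map f = 0) : IsZero (W.obj T) := by
  rw [isZero_iff_injective]
  intro A _ α
  have hα (R : FI) (f : R ⟶ T) (hf : ¬ FI.IsBij f) : W.map f ≫ α = 0 := by
    rw [hW R f hf, zero_comp]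
  rw [← coindLift_app_eval α hα, (vanishes_zero_iff W T).1 h A (coindLift α hα), zero_app,
    zero_comp]

/-- Every non-bijective injection factors through `FI.incl`, which kills `K W` by definition. -/
lemma K_map_eq_zero {R : FI} (f : R ⟶ T) (hf : ¬ FI.IsBij f) : (K W).map f = 0 := by
  obtain ⟨g, rfl⟩ := FI.exists_incl_comp_of_not_isBij f hf
  have h : (K W).map (FI.incl.app R) = 0 := by
    rw [← cancel_mono ((kernel.ι (shiftι W)).app (FI.plus.obj R)), NatTrans.naturality, zero_comp]
    exact kernelι_app_comp_map_incl W R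
  rw [(K W).map_comp]
  exact (congrArg (· ≫ _) h).trans zero_comp

lemma isZero_K_of_vanishes (h : Vanishes 0 (K W) T) : IsZero ((K W).obj T) :=
  isZero_obj_of_vanishes_zero h fun _ f hf => K_map_eq_zero f hf

lemma isZero_K (h : IsZero (W.obj T)) : IsZero ((K W).obj T) :=
  IsZero.of_mono ((kernel.ι (shiftι W)).app T) h

lemma isZero_D (h : IsZero (W.obj (FI.plus.obj T))) : IsZero ((D W).obj T) :=
  IsZero.of_epi ((Dπ W).app T) h

/-- Every map into the empty set is a bijection, so morphisms `X ⟶ coind ∅ A` are just homomorphisms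
`X_∅ → A`. Hence higher homology vanishes at the empty set. -/
instance (A : AddCommGrpCat.{u}) [Injective A] : Injective (coind (FI.pt 0) A) where
  factors {X Y} f i _ := by
    refine ⟨coindLift (Injective.factorThru (f.app _ ≫ coindEval _ A) (i.app _))
      fun R g hg => (hg ⟨(FI.toEmbedding g).injective, fun y => Empty.elim y⟩).elim,
      coind_hom_ext ?_⟩
    rw [NatTrans.comp_app, Category.assoc, coindLift_app_eval, Injective.comp_factorThru]

lemma vanishes_succ_pt_zero (p : ℕ) (W : FIMod.{u}) : Vanishes (p + 1) W (FI.pt 0) :=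
  fun _ _ e => Abelian.Ext.eq_zero_of_injective e

/-- A module without generators is zero. -/
lemma isZero_of_vanishes_zero (h : ∀ n, Vanishes 0 W (FI.pt n)) : IsZero W := by
  have key : ∀ n, IsZero (W.obj (FI.pt n)) := fun n => by
    induction n using Nat.strong_induction_on with
    | _ n ih =>
      refine isZero_obj_of_vanishes_zero (h n) fun R f hf => ?_
      obtain ⟨e⟩ := FI.nonempty_iso_pt (T := R) rfl
      have hR := FI.card_lt_of_not_isBij f hf
      rw [FI.card_pt] at hR
      exact ((W.mapIso e).isZero_iff.2 (ih _ hR)).eq_of_src _ _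
  refine Functor.isZero _ fun T => ?_
  obtain ⟨e⟩ := FI.nonempty_iso_pt (T := T) rfl
  exact (W.mapIso e).isZero_iff.2 (key _)

lemma vanishes_of_isZero (h : IsZero W) (p : ℕ) (T : FI) : Vanishes p W T :=
  fun _ _ => ext_eq_zero_of_isZero h _ p

/-- A module that is zero on large sets has its homology in degree `p` bounded by `p`. -/
lemma vanishes_of_isZero_ge {N : ℕ} (hX : ∀ m, N ≤ m → IsZero (W.obj (FI.pt m))) {n p : ℕ}
    (h : N + p ≤ n) : Vanishes p W (FI.pt n) := by
  induction n generalizing W N p with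
  | zero =>
    obtain rfl : p = 0 := by omega
    exact vanishes_zero_of_isZero (hX 0 (by omega))
  | succ n ih =>
    cases p with
    | zero => exact vanishes_zero_of_isZero (hX _ (by omega))
    | succ p =>
      cases N with
      | zero =>
        exact vanishes_of_isZero
          (isZero_of_vanishes_zero fun m => vanishes_zero_of_isZero (hX m m.zero_le)) _ _
      | succ N =>
        -- `K W` keeps the bound `N + 1` but is needed one homological degree lower; `D W` has the
        -- better bound `N`.
        exact vanishes_succ_plus p (ih (fun m hm => isZero_K (hX m hm)) (by omega))
          (ih (N := N) (fun m hm => isZero_D (hX (m + 1) (by omega))) (by omega))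

/-- The homology of a module that is zero on small sets is zero on small sets. -/
lemma vanishes_of_isZero_le {n : ℕ} (hX : ∀ m, m ≤ n → IsZero (W.obj (FI.pt m))) (p : ℕ) :
    Vanishes p W (FI.pt n) := by
  induction n generalizing W p with
  | zero =>
    cases p with
    | zero => exact vanishes_zero_of_isZero (hX 0 le_rfl)
    | succ p => exact vanishes_succ_pt_zero p W
  | succ n ih =>
    cases p with
    | zero => exact vanishes_zero_of_isZero (hX _ le_rfl)
    | succ p =>
      exact vanishes_succ_plus p (ih (fun m hm => isZero_K (hX m (by omega))) p)
        (ih (fun m hm => isZero_D (hX (m + 1) (by omega))) (p + 1))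

/-- If `H₁(W) = 0`, then all higher homology vanishes. -/
theorem vanishes_of_vanishes_one (h : ∀ n, Vanishes 1 W (FI.pt n)) (p n : ℕ) :
    Vanishes (p + 1) W (FI.pt n) := by
  induction n using Nat.strong_induction_on generalizing W p with
  | _ n ih =>
    cases n with
    | zero => exact vanishes_succ_pt_zero p W
    | succ n =>
      have hD (p m : ℕ) (hm : m ≤ n) : Vanishes (p + 1) (D W) (FI.pt m) :=
        ih m (by omega) (fun k => vanishes_one_deriv (h (k + 1))) p
      -- `D W` inherits `H₁ = 0`, so `H₂(D W)` vanishes up to size `n`, which makes `K W` zero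
      -- there.
      exact vanishes_succ_plus p (vanishes_of_isZero_le (fun m hm => isZero_K_of_vanishes
        (vanishes_zero_K (h (m + 1)) (hD 1 m hm))) p) (hD p n le_rfl)

/-- The regularity of a module is bounded by the degrees of its generators and relations. -/
theorem vanishes_of_bounds {d r : ℕ} (h₀ : ∀ n, d ≤ n → Vanishes 0 W (FI.pt n))
    (h₁ : ∀ n, r < n → Vanishes 1 W (FI.pt n)) {p n : ℕ} (hn : p + 1 + d + r ≤ n + 1) :
    Vanishes (p + 1) W (FI.pt n) := by
  induction d generalizing W r p n with
  | zero =>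
    exact vanishes_of_isZero (isZero_of_vanishes_zero fun m => h₀ m m.zero_le) _ _
  | succ d ih =>
    cases r with
    | zero =>
      -- With `r = 0` only the empty set could carry `H₁`, and it never does.
      refine vanishes_of_vanishes_one (fun m => ?_) p n
      cases m with
      | zero => exact vanishes_succ_pt_zero 0 W
      | succ m => exact h₁ _ m.succ_pos
    | succ r =>
      have hD {q m : ℕ} (hm : q + 1 + d + r ≤ m + 1) : Vanishes (q + 1) (D W) (FI.pt m) :=
        ih (fun k hk => vanishes_zero_deriv (h₀ (k + 1) (by omega)))
          (fun k hk => vanishes_one_deriv (h₁ (k + 1) (by omega))) hm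
      cases n with
      | zero => omega
      | succ n =>
        -- The bound `d + r + 1` is where `H₂(D W)` is known to vanish; there `H₁(W)` vanishes one
        -- size up as well, so `K W` is zero.
        refine vanishes_succ_plus p (vanishes_of_isZero_ge (N := d + r + 1) (fun m hm => ?_)
          (by omega)) (hD (by omega))
        exact isZero_K_of_vanishes (vanishes_zero_K (h₁ (m + 1) (by omega)) (hD (by omega)))

/-! ### Degrees -/

lemma isZero_H_iff (p : ℕ) (W : FIMod.{u}) {T : FB} {n : ℕ} (hT : Nat.card T.carrier = n) :
    IsZero (((H p).obj W).obj T) ↔ Vanishes p W (FI.pt n) := by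
  let T' : FB := ⟨(FI.pt n).carrier⟩
  have e : T ≅ T' :=
    { hom := FI.equivPt hT
      inv := (FI.equivPt hT).symm
      hom_inv_id := Equiv.self_trans_symm _
      inv_hom_id := Equiv.symm_trans_self _ }
  exact (((H p).obj W).mapIso e).isZero_iff.trans (vanishes_iff_isZero_H p W T').symm

lemma le_deg_H {p n : ℕ} {W : FIMod.{u}} (h : ¬ Vanishes p W (FI.pt n)) :
    ((n : ℕ) : EReal) ≤ deg ((H p).obj W) := by
  let T : FB := ⟨(FI.pt n).carrier⟩
  have hT : Nat.card T.carrier = n := FI.card_pt n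
  have := le_iSup₂ (f := fun (T : FB) (_ : ¬ IsZero (((H p).obj W).obj T)) =>
    ((Nat.card T.carrier : ℕ) : EReal)) T (by rwa [isZero_H_iff p W hT])
  rwa [hT] at this

lemma deg_H_cases (p : ℕ) (W : FIMod.{u}) :
    (∀ n, Vanishes p W (FI.pt n)) ∨ deg ((H p).obj W) = ⊤ ∨
      ∃ N : ℕ, deg ((H p).obj W) = N ∧ ∀ n, N < n → Vanishes p W (FI.pt n) := by
  let s : Set ℕ := {n | ¬ Vanishes p W (FI.pt n)}
  have hle (n : ℕ) (hn : n ∈ s) : ((n : ℕ) : EReal) ≤ deg ((H p).obj W) := le_deg_H hn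
  by_cases hs : s.Nonempty
  · refine Or.inr ?_
    by_cases hb : BddAbove s
    · refine Or.inr ⟨sSup s, le_antisymm ?_ (hle _ (Nat.sSup_mem hs hb)), fun n hn => ?_⟩
      · refine iSup₂_le fun T hT => ?_
        rw [isZero_H_iff p W rfl] at hT
        exact_mod_cast le_csSup hb hT
      · by_contra h
        exact absurd (le_csSup hb h) (by omega)
    · left
      rw [EReal.eq_top_iff_forall_lt]
      intro y
      obtain ⟨k, hk⟩ := exists_nat_gt y
      obtain ⟨n, hn, hkn⟩ := not_bddAbove_iff.1 hb k
      refine lt_of_lt_of_le ?_ (hle n hn)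
      exact_mod_cast hk.trans (Nat.cast_lt.2 hkn)
  · left
    intro n
    by_contra h
    exact hs ⟨n, h⟩

lemma deg_H_le_of_vanishes (p : ℕ) (W : FIMod.{u}) (c : EReal)
    (h : ∀ n : ℕ, ¬ Vanishes p W (FI.pt n) → ((n : ℕ) : EReal) ≤ c) : deg ((H p).obj W) ≤ c :=
  iSup₂_le fun _ hT => h _ (by rwa [isZero_H_iff p W rfl] at hT)

lemma isZero_H_one_of_vanishes {W : FIMod.{u}} (h : ∀ n, Vanishes 1 W (FI.pt n)) :
    IsZero ((H 1).obj W) :=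
  Functor.isZero _ fun _ => (isZero_H_iff 1 W rfl).2 (h _)

lemma one_le_deg_H_one {W : FIMod.{u}} (h : ¬ ∀ n, Vanishes 1 W (FI.pt n)) :
    1 ≤ deg ((H 1).obj W) := by
  push Not at h
  obtain ⟨n, hn⟩ := h
  cases n with
  | zero => exact absurd (vanishes_succ_pt_zero 0 W) hn
  | succ n => exact le_trans (by exact_mod_cast Nat.succ_le_succ n.zero_le) (le_deg_H hn)

/-- Since `H₁` vanishes at the empty set, nonzero `H₁` has degree at least one. This gives the case
`p = 0` and rules out `-∞` in the sums. -/
lemma f_one_nonneg {W : FIMod.{u}} (h : ¬ ∀ n, Vanishes 1 W (FI.pt n)) : 0 ≤ f 1 W := by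
  rw [f, EReal.sub_nonneg (Or.inr (EReal.natCast_ne_top 1)) (Or.inr (EReal.natCast_ne_bot 1)),
    Nat.cast_one]
  exact one_le_deg_H_one h

lemma f_zero_eq (W : FIMod.{u}) : f 0 W = deg ((H 0).obj W) := by
  rw [f, Nat.cast_zero, sub_zero]

theorem f_succ_le (W : FIMod.{u}) (p : ℕ) : f (p + 1) W ≤ f 0 W + f 1 W := by
  by_cases h : ∀ n, Vanishes 1 W (FI.pt n)
  · have : deg ((H (p + 1)).obj W) ≤ ⊥ :=
      deg_H_le_of_vanishes _ _ _ fun n hn => absurd (vanishes_of_vanishes_one h p n) hn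
    rw [f, le_bot_iff.1 this, EReal.bot_sub]
    exact bot_le
  · have hf₁ := f_one_nonneg h
    have hbot : f 1 W ≠ ⊥ := fun hb => by simp [hb] at hf₁
    rcases deg_H_cases 0 W with h₀ | h₀ | ⟨N, hN, h₀⟩
    · exact absurd (fun n => vanishes_of_isZero (isZero_of_vanishes_zero h₀) 1 (FI.pt n)) h
    · rw [f_zero_eq, h₀, EReal.top_add_of_ne_bot hbot]
      exact le_top
    rcases deg_H_cases 1 W with h₁ | h₁ | ⟨M, hM, h₁⟩
    · exact absurd h₁ h
    · have : f 1 W = ⊤ := by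
        rw [f, h₁]
        exact EReal.top_sub_coe _
      rw [this, f_zero_eq, hN, EReal.add_top_of_ne_bot (EReal.natCast_ne_bot N)]
      exact le_top
    · have hle : deg ((H (p + 1)).obj W) ≤ ((N + M + p : ℝ) : EReal) := by
        refine deg_H_le_of_vanishes _ _ _ fun n hn => ?_
        have : n ≤ N + M + p := by
          by_contra! hlt
          -- `d` is a strict bound on the degrees of generators, hence `N + 1`, while `r` is
          -- attained, hence `M`.
          exact hn (vanishes_of_bounds (d := N + 1) (r := M) (fun m hm => h₀ m (by omega)) h₁
            (by omega))
        exact_mod_cast this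
      rw [f, f_zero_eq, hN, f, hM]
      refine (EReal.sub_le_sub hle le_rfl).trans ?_
      have : (N + M + p : ℝ) - ((p + 1 : ℕ) : ℝ) = N + (M - ((1 : ℕ) : ℝ)) := by
        push_cast
        ring
      exact (congrArg Real.toEReal this).le

end FIMod

/-- In `EReal` one has `-∞ + x = x + -∞ = -∞` for all `x`, including `x = ∞`. -/
theorem mainTheorem1 (W : FIMod.{u}) :
    (∀ p : ℕ, 1 ≤ p → FIMod.f p W ≤ FIMod.f 0 W + FIMod.f 1 W) ∧
    (¬ IsZero ((FIMod.H 1).obj W) → FIMod.f 0 W ≤ FIMod.f 0 W + FIMod.f 1 W) ∧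
    FIMod.regularity W ≤ FIMod.f 0 W + FIMod.f 1 W := by
  have key (p : ℕ) (hp : 1 ≤ p) : FIMod.f p W ≤ FIMod.f 0 W + FIMod.f 1 W := by
    obtain ⟨p, rfl⟩ := Nat.exists_eq_add_of_le' hp
    exact FIMod.f_succ_le W p
  exact ⟨key, fun h => le_add_of_nonneg_right (FIMod.f_one_nonneg fun h₁ =>
    h (FIMod.isZero_H_one_of_vanishes h₁)), iSup₂_le key⟩
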